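/- Let $M$ be a smooth (finite-dimensional, Hausdorff, second countable) manifold. A double vector bundle $(D;A,E;M)$ is a commutative square of smooth real vector bundles of finite rank $p_D:D\to E$, $p:D\to A$, $p_E:E\to M$, $p_A:A\to M$ in which $p_D$ is a vector bundle morphism over $p_A$ and the addition $+_E:D\times_E D\to D$ of $D\to E$ is a vector bundle morphism over the addition $A\times_M A\to A$. Its core is $C=\ker p\cap\ker p_D$, a vector bundle over $M$ included in $D$ by $c\mapsto\bar c$. A smooth section of $D\to E$ is *linear* over $a\in\Gamma(A)$ if it is a vector bundle morphism from $E\to M$ to $D\to A$ covering $a$; it is a *core section* if it has the form $e\mapsto 0^D_e+_A\overline{c(p_E(e))}$ with $c\in\Gamma(C)$. A *VB-algebroid* is a double vector bundle with Lie algebroid structures on $D\to E$ and on $A\to M$ such that $\rho_D:D\to TE$ is a vector bundle morphism from $D\to A$ to $TE\to TM$ over $\rho_A:A\to TM$; the bracket of two linear sections over $a$ and $b$ is a linear section over $[a,b]_A$; the bracket of a linear section and a core section is a core section; and any two core sections commute. A Lie algebroid *extension* is a fibrewise surjective Lie algebroid morphism over a surjective submersion; an *Ehresmann connection* on it is a smooth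 vector subbundle $H$ complementary to its kernel; it is *complete* if for every section $a$ of the target with complete anchor vector field $\rho(a)$ the anchor vector field of the horizontal lift of $a$ (the section of $H$ that projects to $a$) is complete. A *fibration* of Lie algebroids is an extension that admits a complete Ehresmann connection. **Proposition.** Let $(D;A,E;M)$ be a VB-algebroid with core $C$. Then $p:D\to A$ is a Lie algebroid fibration over $p_E:E\to M$. Its kernel $\ker p\to E$ is a Lie subalgebroid of $D\to E$; the core carries a smooth vector bundle structure over $M$ for which its inclusion into $D$ is smooth, and for any such structure $(e,c)\mapsto 0^D_e+_A\bar c$ is an isomorphism of vector bundles over $E$ from $p_E^*C$ onto $\ker p$. Moreover, Ehresmann connections on $p$ that are linear (all horizontal lifts of sections of $A$ are linear sections of $D\to E$) exist, and every linear Ehresmann connection is complete. -/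

import Mathlib

open Bundle Manifold
open scoped Manifold ContDiff Bundle Topology

noncomputable section

/-! ### Fibrewise operations on the total space of a vector bundle -/

section Fibrewise

variable {B : Type*} {F : Type*} {V : B → Type*} [∀ b, AddCommGroup (V b)] [∀ b, Module ℝ (V b)]

/-- `x`, `y`, `z` lie in one fibre and `z = x + y` there. -/
def FibreSum (x y z : TotalSpace F V) : Prop :=
  ∃ (b : B) (u v : V b), x = ⟨b, u⟩ ∧ y = ⟨b, v⟩ ∧ z = ⟨b, u + v⟩

/-- Fibrewise multiplication by the scalar `t`. -/
def fibreSMul (t : ℝ) (x : TotalSpace F V) : TotalSpace F V := ⟨x.proj, t • x.snd⟩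

end Fibrewise

/-! ### Vector bundles: subbundles, Lie algebroids -/

section LieAlgebroid

variable {EB : Type*} [NormedAddCommGroup EB] [NormedSpace ℝ EB]
  {HB : Type*} [TopologicalSpace HB] (IB : ModelWithCorners ℝ EB HB)
  {B : Type*} [TopologicalSpace B] [ChartedSpace HB B] [IsManifold IB ∞ B]
  (F : Type*) [NormedAddCommGroup F] [NormedSpace ℝ F]
  (V : B → Type*) [TopologicalSpace (TotalSpace F V)]
  [∀ b, AddCommGroup (V b)] [∀ b, Module ℝ (V b)] [∀ b, TopologicalSpace (V b)]
  [FiberBundle F V]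

/-- The derivative of a real function `f` at `b` along the tangent vector `ξ`. -/
def derivAlong (f : B → ℝ) (b : B) (ξ : TangentSpace IB b) : ℝ :=
  (mfderiv IB 𝓘(ℝ, ℝ) f b : TangentSpace IB b →L[ℝ] ℝ) ξ

/-- A vector field is complete if through every point passes an integral curve defined on `ℝ`. -/
def IsCompleteVectorField (Z : (b : B) → TangentSpace IB b) : Prop :=
  ∀ b : B, ∃ γ : ℝ → B, γ 0 = b ∧ IsMIntegralCurve (I := IB) γ Z

variable {V} in
/-- A family of subspaces of the fibres is a smooth vector subbundle if it is locally spanned by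
a smooth frame. -/
def IsSmoothSubbundle (S : (b : B) → Submodule ℝ (V b)) : Prop :=
  ∀ b₀ : B, ∃ U : Set B, IsOpen U ∧ b₀ ∈ U ∧ ∃ (k : ℕ) (s : Fin k → (b : B) → V b),
    (∀ i, ContMDiffOn IB (IB.prod 𝓘(ℝ, F)) ∞ (fun b => (⟨b, s i b⟩ : TotalSpace F V)) U) ∧
    ∀ b ∈ U, LinearIndependent ℝ (fun i => s i b) ∧
      Submodule.span ℝ (Set.range fun i => s i b) = S b

variable [VectorBundle ℝ F V]

/-- A Lie algebroid structure on the vector bundle `V → B`. -/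
structure LieAlgebroid where
  anchor : (b : B) → V b →ₗ[ℝ] TangentSpace IB b
  contMDiff_anchor : ContMDiff (IB.prod 𝓘(ℝ, F)) IB.tangent ∞
    (fun x : TotalSpace F V => (⟨x.proj, anchor x.proj x.snd⟩ : TangentBundle IB B))
  bracket : Cₛ^∞⟮IB; F, V⟯ →ₗ[ℝ] Cₛ^∞⟮IB; F, V⟯ →ₗ[ℝ] Cₛ^∞⟮IB; F, V⟯
  bracket_self : ∀ X, bracket X X = 0
  jacobi : ∀ X Y Z, bracket X (bracket Y Z) = bracket (bracket X Y) Z + bracket Y (bracket X Z)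
  /-- `[X, fY] = f [X, Y] + (ρ(X) f) Y`. -/
  leibniz : ∀ (X Y fY : Cₛ^∞⟮IB; F, V⟯) (f : C^∞⟮IB, B; ℝ⟯), (∀ b, fY b = f b • Y b) →
    ∀ b, bracket X fY b = f b • bracket X Y b + derivAlong IB f b (anchor b (X b)) • Y b

variable {IB F V}

/-- The vector field `ρ(X)`. -/
def LieAlgebroid.anchorField (L : LieAlgebroid IB F V) (X : Cₛ^∞⟮IB; F, V⟯) (b : B) :
    TangentSpace IB b := L.anchor b (X b)

/-- A Lie subalgebroid over the same base: a smooth subbundle whose sections are closed under the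
bracket. -/
structure LieAlgebroid.IsLieSubalgebroid (L : LieAlgebroid IB F V)
    (S : (b : B) → Submodule ℝ (V b)) : Prop where
  isSmoothSubbundle : IsSmoothSubbundle IB F S
  bracket_mem : ∀ X Y : Cₛ^∞⟮IB; F, V⟯, (∀ b, X b ∈ S b) → (∀ b, Y b ∈ S b) →
    ∀ b, L.bracket X Y b ∈ S b

end LieAlgebroid

/-! ### Morphisms, extensions and fibrations of Lie algebroids -/

section Fibration

variable {EB : Type*} [NormedAddCommGroup EB] [NormedSpace ℝ EB]
  {HB : Type*} [TopologicalSpace HB] {IB : ModelWithCorners ℝ EB HB}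
  {B : Type*} [TopologicalSpace B] [ChartedSpace HB B] [IsManifold IB ∞ B]
  {F : Type*} [NormedAddCommGroup F] [NormedSpace ℝ F]
  {V : B → Type*} [TopologicalSpace (TotalSpace F V)]
  [∀ b, AddCommGroup (V b)] [∀ b, Module ℝ (V b)] [∀ b, TopologicalSpace (V b)]
  [FiberBundle F V] [VectorBundle ℝ F V]
  {EB' : Type*} [NormedAddCommGroup EB'] [NormedSpace ℝ EB']
  {HB' : Type*} [TopologicalSpace HB'] {IB' : ModelWithCorners ℝ EB' HB'}
  {B' : Type*} [TopologicalSpace B'] [ChartedSpace HB' B'] [IsManifold IB' ∞ B']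
  {F' : Type*} [NormedAddCommGroup F'] [NormedSpace ℝ F']
  {W : B' → Type*} [TopologicalSpace (TotalSpace F' W)]
  [∀ b, AddCommGroup (W b)] [∀ b, Module ℝ (W b)] [∀ b, TopologicalSpace (W b)]
  [FiberBundle F' W] [VectorBundle ℝ F' W]
  (LV : LieAlgebroid IB F V) (LW : LieAlgebroid IB' F' W)
  (f : B → B') (φ : (b : B) → V b →ₗ[ℝ] W (f b))

/-- `φ : V → W` is a morphism of Lie algebroids over `f : B → B'`: a smooth vector bundle map
which is compatible with the anchors and with the brackets. The latter is expressed through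
decompositions `φ ∘ X = ∑ uᵢ (aᵢ ∘ f)` and `φ ∘ Y = ∑ vⱼ (cⱼ ∘ f)`. -/
structure IsLieAlgebroidMorphism : Prop where
  contMDiff_base : ContMDiff IB IB' ∞ f
  contMDiff_map : ContMDiff (IB.prod 𝓘(ℝ, F)) (IB'.prod 𝓘(ℝ, F')) ∞
    (fun x : TotalSpace F V => (⟨f x.proj, φ x.proj x.snd⟩ : TotalSpace F' W))
  anchor_map : ∀ (b : B) (v : V b),
    LW.anchor (f b) (φ b v) = mfderiv IB IB' f b (LV.anchor b v)
  bracket_map : ∀ (X Y : Cₛ^∞⟮IB; F, V⟯) (k l : ℕ)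
    (u : Fin k → C^∞⟮IB, B; ℝ⟯) (a : Fin k → Cₛ^∞⟮IB'; F', W⟯)
    (v : Fin l → C^∞⟮IB, B; ℝ⟯) (c : Fin l → Cₛ^∞⟮IB'; F', W⟯),
    (∀ b, φ b (X b) = ∑ i, u i b • a i (f b)) →
    (∀ b, φ b (Y b) = ∑ j, v j b • c j (f b)) →
    ∀ b, φ b (LV.bracket X Y b) =
      ∑ i, ∑ j, (u i b * v j b) • LW.bracket (a i) (c j) (f b)
      + ∑ j, derivAlong IB (v j) b (LV.anchor b (X b)) • c j (f b)
      - ∑ i, derivAlong IB (u i) b (LV.anchor b (Y b)) • a i (f b)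

/-- An extension of Lie algebroids: a (fibrewise) surjective morphism over a surjective
submersion. -/
structure IsLieAlgebroidExtension : Prop where
  isMorphism : IsLieAlgebroidMorphism LV LW f φ
  surjective_base : Function.Surjective f
  isSubmersion_base : IsSubmersion IB IB' ∞ f
  surjective_map : ∀ b, Function.Surjective (φ b)

variable (IB F) in
/-- An Ehresmann connection: a smooth subbundle complementary to the kernel of `φ`. -/
structure EhresmannConnection where
  H : (b : B) → Submodule ℝ (V b)
  isSmoothSubbundle : IsSmoothSubbundle IB F H
  isCompl : ∀ b, IsCompl (LinearMap.ker (φ b)) (H b)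

variable {f φ} in
/-- `X` is the horizontal lift `hor(a)` of the section `a`. -/
def EhresmannConnection.IsHorizontalLift (h : EhresmannConnection IB F f φ)
    (a : Cₛ^∞⟮IB'; F', W⟯) (X : Cₛ^∞⟮IB; F, V⟯) : Prop :=
  (∀ b, X b ∈ h.H b) ∧ ∀ b, φ b (X b) = a (f b)

variable {f φ} in
/-- The connection is complete: if `ρ(a)` is complete, so is `ρ(hor(a))`. -/
def EhresmannConnection.IsComplete (h : EhresmannConnection IB F f φ) : Prop :=
  ∀ a : Cₛ^∞⟮IB'; F', W⟯, IsCompleteVectorField IB' (LW.anchorField a) →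
    ∃ X : Cₛ^∞⟮IB; F, V⟯, h.IsHorizontalLift a X ∧ IsCompleteVectorField IB (LV.anchorField X)

/-- A fibration of Lie algebroids: an extension that admits a complete Ehresmann connection. -/
structure IsLieAlgebroidFibration : Prop where
  isExtension : IsLieAlgebroidExtension LV LW f φ
  exists_complete : ∃ h : EhresmannConnection IB F f φ, h.IsComplete LV LW

end Fibration

/-! ### The vector bundle `TE → TM` -/

section TangentProlongation

variable {EM : Type*} [NormedAddCommGroup EM] [NormedSpace ℝ EM]
  {M : Type*} [TopologicalSpace M] [ChartedSpace EM M]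
  {FE : Type*} [NormedAddCommGroup FE] [NormedSpace ℝ FE]
  {E : M → Type*} [TopologicalSpace (TotalSpace FE E)]
  [∀ m, AddCommGroup (E m)] [∀ m, Module ℝ (E m)] [∀ m, TopologicalSpace (E m)]
  [FiberBundle FE E] [VectorBundle ℝ FE E]

/-- Addition in the vector bundle `TE → TM`, that is, the tangent map of the addition
`E ×_M E → E`: `ζ = T(+)(ξ, η)`. -/
def TangentSum (ξ η ζ : TangentBundle (𝓘(ℝ, EM).prod 𝓘(ℝ, FE)) (TotalSpace FE E)) : Prop :=
  ∃ w : TangentBundle (𝓘(ℝ, EM).prod 𝓘(ℝ, FE × FE)) (TotalSpace (FE × FE) (E ×ᵇ E)),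
    tangentMap (𝓘(ℝ, EM).prod 𝓘(ℝ, FE × FE)) (𝓘(ℝ, EM).prod 𝓘(ℝ, FE))
      (fun x : TotalSpace (FE × FE) (E ×ᵇ E) => (⟨x.proj, x.snd.1⟩ : TotalSpace FE E)) w = ξ ∧
    tangentMap (𝓘(ℝ, EM).prod 𝓘(ℝ, FE × FE)) (𝓘(ℝ, EM).prod 𝓘(ℝ, FE))
      (fun x : TotalSpace (FE × FE) (E ×ᵇ E) => (⟨x.proj, x.snd.2⟩ : TotalSpace FE E)) w = η ∧
    tangentMap (𝓘(ℝ, EM).prod 𝓘(ℝ, FE × FE)) (𝓘(ℝ, EM).prod 𝓘(ℝ, FE))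
      (fun x : TotalSpace (FE × FE) (E ×ᵇ E) =>
        (⟨x.proj, x.snd.1 + x.snd.2⟩ : TotalSpace FE E)) w = ζ

end TangentProlongation

/-! ### Double vector bundles and VB-algebroids -/

section VBAlgebroid

variable {EM : Type*} [NormedAddCommGroup EM] [NormedSpace ℝ EM]
  {M : Type*} [TopologicalSpace M] [ChartedSpace EM M]
  (FA : Type*) [NormedAddCommGroup FA] [NormedSpace ℝ FA]
  (A : M → Type*) [TopologicalSpace (TotalSpace FA A)]
  [∀ m, AddCommGroup (A m)] [∀ m, Module ℝ (A m)] [∀ m, TopologicalSpace (A m)]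
  [FiberBundle FA A] [VectorBundle ℝ FA A]
  (FE : Type*) [NormedAddCommGroup FE] [NormedSpace ℝ FE]
  (E : M → Type*) [TopologicalSpace (TotalSpace FE E)]
  [∀ m, AddCommGroup (E m)] [∀ m, Module ℝ (E m)] [∀ m, TopologicalSpace (E m)]
  [FiberBundle FE E] [VectorBundle ℝ FE E]
  (F₁ : Type*) [NormedAddCommGroup F₁] [NormedSpace ℝ F₁]
  (D₁ : TotalSpace FE E → Type*) [TopologicalSpace (TotalSpace F₁ D₁)]
  [∀ e, AddCommGroup (D₁ e)] [∀ e, Module ℝ (D₁ e)] [∀ e, TopologicalSpace (D₁ e)]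
  [FiberBundle F₁ D₁] [VectorBundle ℝ F₁ D₁]
  (F₂ : Type*) [NormedAddCommGroup F₂] [NormedSpace ℝ F₂]
  (D₂ : TotalSpace FA A → Type*) [TopologicalSpace (TotalSpace F₂ D₂)]
  [∀ a, AddCommGroup (D₂ a)] [∀ a, Module ℝ (D₂ a)] [∀ a, TopologicalSpace (D₂ a)]
  [FiberBundle F₂ D₂] [VectorBundle ℝ F₂ D₂]

/-- A double vector bundle `(D; A, E; M)`. The manifold `D` with its vector bundle structure over
`E` is the total space of `D₁`, the same manifold with its vector bundle structure over `A` is the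
total space of `D₂`, and `flip` identifies the two. -/
structure DoubleVectorBundle where
  flip : TotalSpace F₁ D₁ ≃ₘ⟮(𝓘(ℝ, EM).prod 𝓘(ℝ, FE)).prod 𝓘(ℝ, F₁),
    (𝓘(ℝ, EM).prod 𝓘(ℝ, FA)).prod 𝓘(ℝ, F₂)⟯ TotalSpace F₂ D₂
  /-- The projection `p : D → A`, on the fibre of `D → E` over `e`. -/
  p : (e : TotalSpace FE E) → D₁ e →ₗ[ℝ] A e.proj
  proj_flip : ∀ (e : TotalSpace FE E) (d : D₁ e), (flip ⟨e, d⟩).proj = ⟨e.proj, p e d⟩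
  /-- The projection `p_D : D → E`, on the fibre of `D → A` over `a`. -/
  pD : (a : TotalSpace FA A) → D₂ a →ₗ[ℝ] E a.proj
  proj_flip_symm : ∀ (a : TotalSpace FA A) (d : D₂ a),
    (flip.symm ⟨a, d⟩).proj = ⟨a.proj, pD a d⟩
  /-- `(d₁ +_A d₂) +_E (d₃ +_A d₄) = (d₁ +_E d₃) +_A (d₂ +_E d₄)`. -/
  interchange : ∀ d₁ d₂ d₃ d₄ d₁₂ d₃₄ d₁₃ d₂₄ d : TotalSpace F₁ D₁,
    FibreSum (flip d₁) (flip d₂) (flip d₁₂) → FibreSum (flip d₃) (flip d₄) (flip d₃₄) →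
    FibreSum d₁ d₃ d₁₃ → FibreSum d₂ d₄ d₂₄ →
    FibreSum d₁₂ d₃₄ d → FibreSum (flip d₁₃) (flip d₂₄) (flip d)
  /-- `(t ·_A d₁) +_E (t ·_A d₂) = t ·_A (d₁ +_E d₂)`. -/
  smul_interchange : ∀ (t : ℝ) (d₁ d₂ d : TotalSpace F₁ D₁), FibreSum d₁ d₂ d →
    FibreSum (flip.symm (fibreSMul t (flip d₁))) (flip.symm (fibreSMul t (flip d₂)))
      (flip.symm (fibreSMul t (flip d)))

variable {FA A FE E F₁ D₁ F₂ D₂}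

namespace DoubleVectorBundle

variable (𝒟 : DoubleVectorBundle (EM := EM) FA A FE E F₁ D₁ F₂ D₂)

/-- `d = d₁ +_A d₂`. -/
def SumA (d₁ d₂ d : TotalSpace F₁ D₁) : Prop := FibreSum (𝒟.flip d₁) (𝒟.flip d₂) (𝒟.flip d)

/-- `t ·_A d`. -/
def smulA (t : ℝ) (d : TotalSpace F₁ D₁) : TotalSpace F₁ D₁ :=
  𝒟.flip.symm (fibreSMul t (𝒟.flip d))

/-- The fibre over `m` of the core: the elements of `D` over `0 ∈ E_m` and over `0 ∈ A_m`. -/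
def core (m : M) : Submodule ℝ (D₁ ⟨m, 0⟩) := LinearMap.ker (𝒟.p ⟨m, 0⟩)

/-- The core bundle, as a family of vector spaces over `M`. -/
abbrev Core (m : M) : Type _ := 𝒟.core m

/-- The inclusion `c ↦ c̄` of the core into `D`. -/
def coreIncl (m : M) (c : 𝒟.Core m) : TotalSpace F₁ D₁ := ⟨⟨m, 0⟩, (c : D₁ ⟨m, 0⟩)⟩

/-- A section `X` of `D → E` is linear over the section `a` of `A`: it is a vector bundle morphism
from `E → M` to `D → A` covering `a`. -/
structure IsLinearSection (X : Cₛ^∞⟮𝓘(ℝ, EM).prod 𝓘(ℝ, FE); F₁, D₁⟯)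
    (a : Cₛ^∞⟮𝓘(ℝ, EM); FA, A⟯) : Prop where
  covers : ∀ e, 𝒟.p e (X e) = a e.proj
  map_add : ∀ e₁ e₂ e : TotalSpace FE E, FibreSum e₁ e₂ e →
    𝒟.SumA ⟨e₁, X e₁⟩ ⟨e₂, X e₂⟩ ⟨e, X e⟩
  map_smul : ∀ (t : ℝ) (e : TotalSpace FE E),
    (⟨fibreSMul t e, X (fibreSMul t e)⟩ : TotalSpace F₁ D₁) = 𝒟.smulA t ⟨e, X e⟩

/-- A section `X` of `D → E` is a core section: `X(e) = 0_e +_A c̄(m)` for `e ∈ E_m`, for a smooth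
section `c` of the core. -/
def IsCoreSection (X : Cₛ^∞⟮𝓘(ℝ, EM).prod 𝓘(ℝ, FE); F₁, D₁⟯) : Prop :=
  ∃ c : (m : M) → 𝒟.Core m,
    ContMDiff 𝓘(ℝ, EM) ((𝓘(ℝ, EM).prod 𝓘(ℝ, FE)).prod 𝓘(ℝ, F₁)) ∞
      (fun m => 𝒟.coreIncl m (c m)) ∧
    ∀ e : TotalSpace FE E, 𝒟.SumA ⟨e, 0⟩ (𝒟.coreIncl e.proj (c e.proj)) ⟨e, X e⟩

/-- The smooth vector bundle structure on the core, of rank `k`, for which the inclusion into `D`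
is smooth. -/
class CoreBundle (k : ℕ) where
  topology : TopologicalSpace (TotalSpace (Fin k → ℝ) 𝒟.Core)
  fiberBundle : FiberBundle (Fin k → ℝ) 𝒟.Core
  vectorBundle : VectorBundle ℝ (Fin k → ℝ) 𝒟.Core
  contMDiffVectorBundle : ContMDiffVectorBundle ∞ (Fin k → ℝ) 𝒟.Core 𝓘(ℝ, EM)
  contMDiff_coreIncl : ContMDiff (𝓘(ℝ, EM).prod 𝓘(ℝ, Fin k → ℝ))
    ((𝓘(ℝ, EM).prod 𝓘(ℝ, FE)).prod 𝓘(ℝ, F₁)) ∞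
    (fun c : TotalSpace (Fin k → ℝ) 𝒟.Core => 𝒟.coreIncl c.proj c.snd)

attribute [reducible] CoreBundle.topology CoreBundle.fiberBundle

attribute [instance] CoreBundle.topology CoreBundle.fiberBundle CoreBundle.vectorBundle
  CoreBundle.contMDiffVectorBundle

variable (EM FE E) in
/-- The projection `p_E : E → M`, as a smooth map. -/
def projE : C^∞⟮𝓘(ℝ, EM).prod 𝓘(ℝ, FE), TotalSpace FE E; 𝓘(ℝ, EM), M⟯ :=
  ⟨TotalSpace.proj, contMDiff_proj E⟩

/-- `i` is the canonical map `p_E^* C → D`, `(e, c) ↦ 0_e +_A c̄`, and it is an isomorphism of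
vector bundles over `E` from `p_E^* C` onto the kernel of `p`: it is smooth, fibrewise linear and
injective, and its image is `ker p`. -/
structure IsKernelIso (k : ℕ) [𝒟.CoreBundle k]
    (i : (e : TotalSpace FE E) → ((projE EM FE E) *ᵖ 𝒟.Core) e →ₗ[ℝ] D₁ e) : Prop where
  apply_eq : ∀ (e : TotalSpace FE E) (c : 𝒟.Core e.proj),
    𝒟.SumA ⟨e, 0⟩ (𝒟.coreIncl e.proj c) ⟨e, i e c⟩
  contMDiff : ContMDiff ((𝓘(ℝ, EM).prod 𝓘(ℝ, FE)).prod 𝓘(ℝ, Fin k → ℝ))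
    ((𝓘(ℝ, EM).prod 𝓘(ℝ, FE)).prod 𝓘(ℝ, F₁)) ∞
    (fun x : TotalSpace (Fin k → ℝ) ((projE EM FE E) *ᵖ 𝒟.Core) =>
      (⟨x.proj, i x.proj x.snd⟩ : TotalSpace F₁ D₁))
  injective : ∀ e, Function.Injective (i e)
  range_eq : ∀ e, LinearMap.range (i e) = LinearMap.ker (𝒟.p e)

end DoubleVectorBundle

variable [IsManifold 𝓘(ℝ, EM) ∞ M] [ContMDiffVectorBundle ∞ FE E 𝓘(ℝ, EM)]

/-- The compatibility of Lie algebroid structures on `D → E` and on `A → M` which makes a double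
vector bundle a VB-algebroid. -/
structure IsVBAlgebroid (𝒟 : DoubleVectorBundle (EM := EM) FA A FE E F₁ D₁ F₂ D₂)
    (LD : LieAlgebroid (𝓘(ℝ, EM).prod 𝓘(ℝ, FE)) F₁ D₁) (LA : LieAlgebroid 𝓘(ℝ, EM) FA A) :
    Prop where
  /-- `ρ_D : D → TE` covers `ρ_A : A → TM`. -/
  anchor_covers : ∀ (e : TotalSpace FE E) (d : D₁ e),
    mfderiv (𝓘(ℝ, EM).prod 𝓘(ℝ, FE)) 𝓘(ℝ, EM) (TotalSpace.proj : TotalSpace FE E → M) e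
      (LD.anchor e d) = LA.anchor e.proj (𝒟.p e d)
  /-- `ρ_D` is additive from the fibres of `D → A` to those of `TE → TM`. -/
  anchor_add : ∀ d₁ d₂ d : TotalSpace F₁ D₁, 𝒟.SumA d₁ d₂ d →
    TangentSum (E := E) ⟨d₁.proj, LD.anchor d₁.proj d₁.snd⟩
      ⟨d₂.proj, LD.anchor d₂.proj d₂.snd⟩ ⟨d.proj, LD.anchor d.proj d.snd⟩
  /-- `ρ_D` is homogeneous from the fibres of `D → A` to those of `TE → TM`. -/
  anchor_smul : ∀ (t : ℝ) (d : TotalSpace F₁ D₁),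
    (⟨(𝒟.smulA t d).proj, LD.anchor (𝒟.smulA t d).proj (𝒟.smulA t d).snd⟩ :
      TangentBundle (𝓘(ℝ, EM).prod 𝓘(ℝ, FE)) (TotalSpace FE E)) =
    tangentMap (𝓘(ℝ, EM).prod 𝓘(ℝ, FE)) (𝓘(ℝ, EM).prod 𝓘(ℝ, FE)) (fibreSMul t)
      ⟨d.proj, LD.anchor d.proj d.snd⟩
  /-- The bracket of linear sections is linear, over the bracket of the sections of `A` that they
  cover. -/
  bracket_linear_linear : ∀ X Y a b, 𝒟.IsLinearSection X a → 𝒟.IsLinearSection Y b →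
    𝒟.IsLinearSection (LD.bracket X Y) (LA.bracket a b)
  bracket_linear_core : ∀ X Y a, 𝒟.IsLinearSection X a → 𝒟.IsCoreSection Y →
    𝒟.IsCoreSection (LD.bracket X Y)
  bracket_core_core : ∀ X Y, 𝒟.IsCoreSection X → 𝒟.IsCoreSection Y → LD.bracket X Y = 0

/-- An Ehresmann connection on `p : D → A` is linear if its horizontal lifts are linear
sections. -/
def DoubleVectorBundle.IsLinearConnection
    (𝒟 : DoubleVectorBundle (EM := EM) FA A FE E F₁ D₁ F₂ D₂)
    (h : EhresmannConnection (𝓘(ℝ, EM).prod 𝓘(ℝ, FE)) F₁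
      (TotalSpace.proj : TotalSpace FE E → M) 𝒟.p) : Prop :=
  ∀ (a : Cₛ^∞⟮𝓘(ℝ, EM); FA, A⟯), ∃ X : Cₛ^∞⟮𝓘(ℝ, EM).prod 𝓘(ℝ, FE); F₁, D₁⟯,
    h.IsHorizontalLift a X ∧ 𝒟.IsLinearSection X a

end VBAlgebroid

end

/-! The heart of the matter is a bilinear splitting `θ` of `D → E ×_M A`: a right inverse of `p` on
each fibre of `D → E`, linear in `a ∈ A_m`, whose values at fixed `a` form a linear family in `e ∈
E_m`. Since `pD` is onto, it has local right inverses, linear in `e`, along any local section of `A`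
(`exists_local_linear_section`). Doing this for a frame of `A` gives local splittings, and a
partition of unity on `M` glues them (`exists_isLinearLiftOn_univ`), because linear families form a
vector space and `p ∘ θ = id` is an affine condition. The images of `θ` form a linear Ehresmann
connection.

Completeness uses only homogeneity. The anchor field `Z` of a linear section over `a` is invariant
under fibrewise scaling and projects to `ρ(a)`. Any point of a nearby fibre can be scaled close to
the zero section, so the time of existence of integral curves of `Z` is bounded below uniformly on
whole fibres, locally in `M`. Over a compact piece of an integral curve of `ρ(a)` one bound
suffices, so integral curves of `Z` live as long as those of `ρ(a)`
(`IsCompleteVectorField.of_homogeneous`).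

For the kernel, `c ↦ 0_e +_A c̄` identifies the core at `p_E(e)` with `ker p` at `e`, since one may
subtract `0_e` in the fibre of `D → A` over zero. Hence core sections locally generate the sections
of `ker p` over the functions on `E` (`exists_smul_eq_sum_coreSection`). By the Leibniz rule the
axioms on linear-core and core-core brackets then say that bracketing with linear sections, and with
sections of `ker p`, preserves `ker p`. Together with the linear-linear axiom this gives the bracket
condition for a morphism, after every section is written as a combination of linear lifts plus a
section of `ker p` (`map_bracket_eq_sum_of_lift`).

The bundle structure of the core comes from splitting `p` locally along the zero section of `E`
(`exists_coreChart`); smoothness is always tested in `D`. -/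

set_option linter.unusedSectionVars false

/-! ### Vector bundles: topology of the total space and smooth fibrewise operations -/

section TotalSpaceTopology

variable {B F : Type*} {V : B → Type*} [TopologicalSpace B] [TopologicalSpace F]
  [TopologicalSpace (TotalSpace F V)] [∀ b, TopologicalSpace (V b)] [FiberBundle F V]

/-- The total space of a fibre bundle with Hausdorff base and fibre is Hausdorff. -/
theorem FiberBundle.t2Space_totalSpace [T2Space B] [T2Space F] : T2Space (TotalSpace F V) := by
  refine ⟨fun x y hxy => ?_⟩
  by_cases h : x.proj = y.proj
  · let e := trivializationAt F V x.proj
    have hx : x ∈ e.source := FiberBundle.mem_trivializationAt_proj_source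
    have hy : y ∈ e.source := by
      rw [e.mem_source, ← h]
      exact FiberBundle.mem_baseSet_trivializationAt F V x.proj
    exact e.toOpenPartialHomeomorph.open_source |> fun ho => by
      obtain ⟨u, v, hu, hv, hxu, hyv, huv⟩ := t2_separation (e.injOn.ne hx hy hxy)
      exact ⟨e.source ∩ e ⁻¹' u, e.source ∩ e ⁻¹' v,
        e.continuousOn.isOpen_inter_preimage ho hu, e.continuousOn.isOpen_inter_preimage ho hv,
        ⟨hx, hxu⟩, ⟨hy, hyv⟩,
        (huv.preimage e).mono Set.inter_subset_right Set.inter_subset_right⟩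
  · obtain ⟨u, v, hu, hv, hxu, hyv, huv⟩ := t2_separation h
    have hc := FiberBundle.continuous_proj F V
    exact ⟨_, _, hu.preimage hc, hv.preimage hc, hxu, hyv, huv.preimage _⟩

end TotalSpaceTopology

section SmoothFibrewise

variable {EB : Type*} [NormedAddCommGroup EB] [NormedSpace ℝ EB]
  {HB : Type*} [TopologicalSpace HB] {IB : ModelWithCorners ℝ EB HB}
  {B : Type*} [TopologicalSpace B] [ChartedSpace HB B]
  {F : Type*} [NormedAddCommGroup F] [NormedSpace ℝ F]
  {V : B → Type*} [TopologicalSpace (TotalSpace F V)]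
  [∀ b, AddCommGroup (V b)] [∀ b, Module ℝ (V b)] [∀ b, TopologicalSpace (V b)]
  [FiberBundle F V] [VectorBundle ℝ F V]

theorem Bundle.Trivialization.snd_add (e : Trivialization F (TotalSpace.proj : TotalSpace F V → B))
    [e.IsLinear ℝ] {b : B} (hb : b ∈ e.baseSet) (u v : V b) :
    (e ⟨b, u + v⟩).2 = (e ⟨b, u⟩).2 + (e ⟨b, v⟩).2 := (e.linear ℝ hb).map_add u v

theorem Bundle.Trivialization.snd_smul (e : Trivialization F (TotalSpace.proj : TotalSpace F V → B))
    [e.IsLinear ℝ] {b : B} (hb : b ∈ e.baseSet) (t : ℝ) (u : V b) :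
    (e ⟨b, t • u⟩).2 = t • (e ⟨b, u⟩).2 := (e.linear ℝ hb).map_smul t u

theorem Bundle.Trivialization.snd_injective
    (e : Trivialization F (TotalSpace.proj : TotalSpace F V → B)) {b : B} (hb : b ∈ e.baseSet) :
    Function.Injective fun u : V b => (e ⟨b, u⟩).2 := by
  intro u v h
  rw [← e.symm_apply_apply_mk hb u, ← e.symm_apply_apply_mk hb v]
  exact congrArg _ h

/-- An additive map from `ℝ` into a fibre which is continuous as a map into the total space is
linear. -/
theorem map_real_smul_of_continuous_totalSpace {b : B} (g : ℝ →+ V b)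
    (hg : Continuous fun t => (⟨b, g t⟩ : TotalSpace F V)) (t : ℝ) : g t = t • g 1 := by
  have hb := FiberBundle.mem_baseSet_trivializationAt F V b
  let e := trivializationAt F V b
  -- The fibre is transported to the normed space `F`, where continuous additive maps are known to
  -- be `ℝ`-linear.
  let g' : ℝ →+ F :=
    (AddMonoidHom.mk' (fun u : V b => (e ⟨b, u⟩).2) fun u v => e.snd_add hb u v).comp g
  have hg' : Continuous g' := by
    have h1 : Continuous fun t => e ⟨b, g t⟩ :=
      e.continuousOn.comp_continuous hg fun t => e.mem_source.2 hb
    exact continuous_snd.comp h1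
  refine e.snd_injective hb ?_
  have := map_real_smul g' hg' t 1
  simp only [smul_eq_mul, mul_one] at this
  exact this.trans (e.snd_smul hb t (g 1)).symm

variable {EQ : Type*} [NormedAddCommGroup EQ] [NormedSpace ℝ EQ]
  {HQ : Type*} [TopologicalSpace HQ] {IQ : ModelWithCorners ℝ EQ HQ}
  {Q : Type*} [TopologicalSpace Q] [ChartedSpace HQ Q] {f g h : Q → TotalSpace F V} {s : Set Q}
  {q₀ : Q}

theorem FibreSum.proj_left {x y z : TotalSpace F V} (h : FibreSum x y z) : x.proj = z.proj := by
  obtain ⟨b, u, v, rfl, rfl, rfl⟩ := h; rfl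

theorem FibreSum.proj_right {x y z : TotalSpace F V} (h : FibreSum x y z) : y.proj = z.proj := by
  obtain ⟨b, u, v, rfl, rfl, rfl⟩ := h; rfl

theorem FibreSum.symm {x y z : TotalSpace F V} (h : FibreSum x y z) : FibreSum y x z := by
  obtain ⟨b, u, v, rfl, rfl, rfl⟩ := h
  exact ⟨b, v, u, rfl, rfl, by rw [add_comm]⟩

theorem FibreSum.trivialization {x y z : TotalSpace F V} (h : FibreSum x y z)
    (e : Trivialization F (TotalSpace.proj : TotalSpace F V → B)) [e.IsLinear ℝ]
    (he : z.proj ∈ e.baseSet) : (e z).2 = (e x).2 + (e y).2 := by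
  obtain ⟨b, u, v, rfl, rfl, rfl⟩ := h
  exact e.snd_add he u v

/-- A trivialization turns the relation into addition in `F`. The relational form avoids casts
between fibres, as the base points agree only propositionally. -/
theorem ContMDiffAt.fibreSum (hf : ContMDiffAt IQ (IB.prod 𝓘(ℝ, F)) ∞ f q₀)
    (hg : ContMDiffAt IQ (IB.prod 𝓘(ℝ, F)) ∞ g q₀)
    (hs : ∀ᶠ q in 𝓝 q₀, FibreSum (f q) (g q) (h q)) :
    ContMDiffAt IQ (IB.prod 𝓘(ℝ, F)) ∞ h q₀ := by
  have h0 := hs.self_of_nhds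
  have hp : (fun q => (h q).proj) =ᶠ[𝓝 q₀] fun q => (f q).proj :=
    hs.mono fun q hq => hq.proj_left.symm
  rw [contMDiffAt_totalSpace] at hf hg ⊢
  have hpc : ContMDiffAt IQ IB ∞ (fun q => (h q).proj) q₀ := hf.1.congr_of_eventuallyEq hp
  refine ⟨hpc, ?_⟩
  rw [← h0.proj_left] at *
  have hg2 := hg.2
  rw [h0.proj_right, ← h0.proj_left] at hg2
  refine (hf.2.add hg2).congr_of_eventuallyEq ?_
  have hb : ∀ᶠ q in 𝓝 q₀, (h q).proj ∈ (trivializationAt F V (f q₀).proj).baseSet :=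
    hpc.continuousAt.preimage_mem_nhds
      ((trivializationAt F V (f q₀).proj).open_baseSet.mem_nhds (by
        rw [← h0.proj_left]; exact FiberBundle.mem_baseSet_trivializationAt F V _))
  filter_upwards [hs, hb] with q hq hqb
  exact hq.trivialization _ hqb

theorem ContMDiffAt.fibreSMul {t : Q → ℝ} (ht : ContMDiffAt IQ 𝓘(ℝ, ℝ) ∞ t q₀)
    (hf : ContMDiffAt IQ (IB.prod 𝓘(ℝ, F)) ∞ f q₀) :
    ContMDiffAt IQ (IB.prod 𝓘(ℝ, F)) ∞ (fun q => _root_.fibreSMul (t q) (f q)) q₀ := by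
  rw [contMDiffAt_totalSpace] at hf ⊢
  refine ⟨hf.1, ?_⟩
  refine (ht.smul hf.2).congr_of_eventuallyEq ?_
  have hb : ∀ᶠ q in 𝓝 q₀, (f q).proj ∈ (trivializationAt F V (f q₀).proj).baseSet :=
    hf.1.continuousAt.preimage_mem_nhds
      ((trivializationAt F V (f q₀).proj).open_baseSet.mem_nhds
        (FiberBundle.mem_baseSet_trivializationAt F V _))
  filter_upwards [hb] with q hqb
  exact Trivialization.snd_smul _ hqb _ _

theorem fibreSum_fibreSMul_neg_one {x y z : TotalSpace F V} (h : FibreSum x y z) :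
    FibreSum z (fibreSMul (-1) y) x := by
  obtain ⟨b, u, v, rfl, rfl, rfl⟩ := h
  exact ⟨b, u + v, -v, rfl, by simp [fibreSMul], by simp⟩

theorem ContMDiffAt.of_fibreSum (hh : ContMDiffAt IQ (IB.prod 𝓘(ℝ, F)) ∞ h q₀)
    (hg : ContMDiffAt IQ (IB.prod 𝓘(ℝ, F)) ∞ g q₀)
    (hs : ∀ᶠ q in 𝓝 q₀, FibreSum (f q) (g q) (h q)) :
    ContMDiffAt IQ (IB.prod 𝓘(ℝ, F)) ∞ f q₀ :=
  hh.fibreSum (contMDiffAt_const (c := (-1 : ℝ)) |>.fibreSMul hg)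
    (hs.mono fun _ hq => fibreSum_fibreSMul_neg_one hq)

end SmoothFibrewise

/-! ### Local splittings of vector bundle morphisms -/

/-- A surjective linear map of finite-dimensional spaces is the first component of an isomorphism
onto a product. -/
theorem ContinuousLinearMap.exists_isInvertible_prod {F F' : Type*} [NormedAddCommGroup F]
    [NormedSpace ℝ F] [FiniteDimensional ℝ F] [NormedAddCommGroup F'] [NormedSpace ℝ F']
    [FiniteDimensional ℝ F'] (P : F →L[ℝ] F') (hP : Function.Surjective P) :
    ∃ q : F →L[ℝ] (Fin (Module.finrank ℝ F - Module.finrank ℝ F') → ℝ), (P.prod q).IsInvertible := by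
  have hrank := LinearMap.finrank_range_add_finrank_ker P.toLinearMap
  rw [LinearMap.range_eq_top.2 hP, finrank_top] at hrank
  -- `r` projects onto `ker P`, so `(P, r)` is injective; rank-nullity identifies `ker P` with the
  -- coordinate space.
  obtain ⟨r, hr⟩ := LinearMap.exists_leftInverse_of_injective
    (LinearMap.ker P.toLinearMap).subtype (Submodule.ker_subtype _)
  have hk : Module.finrank ℝ (LinearMap.ker P.toLinearMap) =
      Module.finrank ℝ (Fin (Module.finrank ℝ F - Module.finrank ℝ F') → ℝ) := by
    rw [Module.finrank_fin_fun]; omega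
  let j := LinearEquiv.ofFinrankEq _ _ hk
  refine ⟨(j.toLinearMap ∘ₗ r).toContinuousLinearMap, ?_⟩
  have hinj : Function.Injective (P.prod (j.toLinearMap ∘ₗ r).toContinuousLinearMap).toLinearMap := by
    rw [← LinearMap.ker_eq_bot, LinearMap.ker_eq_bot']
    intro v hv
    have h1 : P v = 0 := congrArg Prod.fst hv
    have h2 : r v = 0 := j.injective ((congrArg Prod.snd hv).trans (map_zero j).symm)
    have h3 := LinearMap.congr_fun hr ⟨v, h1⟩
    rw [LinearMap.comp_apply, Submodule.subtype_apply, h2] at h3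
    exact (congrArg Subtype.val h3).symm
  have hdim : Module.finrank ℝ F =
      Module.finrank ℝ (F' × (Fin (Module.finrank ℝ F - Module.finrank ℝ F') → ℝ)) := by
    rw [Module.finrank_prod, Module.finrank_fin_fun]; omega
  exact ⟨(LinearEquiv.ofInjectiveOfFinrankEq _ hinj hdim).toContinuousLinearEquiv, by ext <;> rfl⟩

section ClmApply

variable {EN : Type*} [NormedAddCommGroup EN] [NormedSpace ℝ EN]
  {HN : Type*} [TopologicalSpace HN] {IN : ModelWithCorners ℝ EN HN}
  {N : Type*} [TopologicalSpace N] [ChartedSpace HN N]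
  {F' : Type*} [NormedAddCommGroup F'] [NormedSpace ℝ F']
  {F : Type*} [NormedAddCommGroup F] [NormedSpace ℝ F] [FiniteDimensional ℝ F]

/-- A family of linear maps on a finite-dimensional space is smooth if it is pointwise smooth. -/
theorem ContMDiffOn.clm_of_apply {P : N → F →L[ℝ] F'} {U : Set N}
    (hP : ∀ v, ContMDiffOn IN 𝓘(ℝ, F') ∞ (fun n => P n v) U) :
    ContMDiffOn IN 𝓘(ℝ, F →L[ℝ] F') ∞ P U := by
  let b := Module.finBasis ℝ F
  let c : Fin (Module.finrank ℝ F) → F →L[ℝ] ℝ := fun i => (b.coord i).toContinuousLinearMap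
  have hsum : P = fun n => ∑ i, ContinuousLinearMap.smulRightL ℝ F F' (c i) (P n (b i)) := by
    funext n
    ext v
    simp only [sum_apply, ContinuousLinearMap.smulRightL_apply_apply]
    conv_lhs => rw [← b.sum_repr v]
    simp only [map_sum, map_smul]
    rfl
  rw [hsum]
  refine contMDiffOn_finsetSum fun i _ => ?_
  exact (ContinuousLinearMap.contMDiff _).comp_contMDiffOn (hP (b i))

end ClmApply

section LocalSplitting

variable {EB : Type*} [NormedAddCommGroup EB] [NormedSpace ℝ EB]
  {HB : Type*} [TopologicalSpace HB] {IB : ModelWithCorners ℝ EB HB}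
  {B : Type*} [TopologicalSpace B] [ChartedSpace HB B]
  {F : Type*} [NormedAddCommGroup F] [NormedSpace ℝ F] [FiniteDimensional ℝ F]
  {V : B → Type*} [TopologicalSpace (TotalSpace F V)]
  [∀ b, AddCommGroup (V b)] [∀ b, Module ℝ (V b)] [∀ b, TopologicalSpace (V b)]
  [FiberBundle F V] [VectorBundle ℝ F V] [ContMDiffVectorBundle ∞ F V IB]
  {EB' : Type*} [NormedAddCommGroup EB'] [NormedSpace ℝ EB']
  {HB' : Type*} [TopologicalSpace HB'] {IB' : ModelWithCorners ℝ EB' HB'}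
  {B' : Type*} [TopologicalSpace B'] [ChartedSpace HB' B']
  {F' : Type*} [NormedAddCommGroup F'] [NormedSpace ℝ F'] [FiniteDimensional ℝ F']
  {W : B' → Type*} [TopologicalSpace (TotalSpace F' W)]
  [∀ b, AddCommGroup (W b)] [∀ b, Module ℝ (W b)] [∀ b, TopologicalSpace (W b)]
  [FiberBundle F' W] [VectorBundle ℝ F' W] [ContMDiffVectorBundle ∞ F' W IB']
  {EN : Type*} [NormedAddCommGroup EN] [NormedSpace ℝ EN]
  {HN : Type*} [TopologicalSpace HN] {IN : ModelWithCorners ℝ EN HN}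
  {N : Type*} [TopologicalSpace N] [ChartedSpace HN N]
  {f : B → B'} {Φ : (b : B) → V b →ₗ[ℝ] W (f b)} {z : N → B}

/-- Let `Φ : V → W` be a smooth vector bundle morphism over `f`, and `z : N → B` a smooth map such
that `Φ` is onto at `z n₀`. Near `n₀`, in the trivializations `eV` and `eW`, the pullback of `V` along
`z` splits as the sum of the pullback of `W` and a trivial bundle. -/
theorem exists_local_splitting
    (hΦ : ContMDiff (IB.prod 𝓘(ℝ, F)) (IB'.prod 𝓘(ℝ, F')) ∞
      (fun x : TotalSpace F V => (⟨f x.proj, Φ x.proj x.snd⟩ : TotalSpace F' W)))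
    {U₀ : Set N} (hU₀ : IsOpen U₀) (hz : ContMDiffOn IN IB ∞ z U₀) {n₀ : N} (hn₀ : n₀ ∈ U₀)
    (hsurj : Function.Surjective (Φ (z n₀)))
    (eV : Trivialization F (TotalSpace.proj : TotalSpace F V → B)) [MemTrivializationAtlas eV]
    (eW : Trivialization F' (TotalSpace.proj : TotalSpace F' W → B')) [MemTrivializationAtlas eW]
    (heV : z n₀ ∈ eV.baseSet) (heW : f (z n₀) ∈ eW.baseSet) :
    ∃ U ⊆ U₀, IsOpen U ∧ n₀ ∈ U ∧
    ∃ (q : F →L[ℝ] (Fin (Module.finrank ℝ F - Module.finrank ℝ F') → ℝ))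
      (S : N → (F' × (Fin (Module.finrank ℝ F - Module.finrank ℝ F') → ℝ)) →L[ℝ] F),
      ContMDiffOn IN 𝓘(ℝ, (F' × (Fin (Module.finrank ℝ F - Module.finrank ℝ F') → ℝ)) →L[ℝ] F) ∞
        S U ∧
      ∀ n ∈ U, z n ∈ eV.baseSet ∧ f (z n) ∈ eW.baseSet ∧
        (∀ v : V (z n), S n ((eW ⟨f (z n), Φ (z n) v⟩).2, q (eV ⟨z n, v⟩).2) = (eV ⟨z n, v⟩).2) ∧
        ∀ w c, (eW ⟨f (z n), Φ (z n) (eV.symm (z n) (S n (w, c)))⟩).2 = w ∧ q (S n (w, c)) = c := by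
  let k := Module.finrank ℝ F - Module.finrank ℝ F'
  -- Continuity of the base map is recovered from that of `Φ` on the zero section.
  have hf : Continuous f := by
    have : f = fun b => (⟨f b, Φ b 0⟩ : TotalSpace F' W).proj := rfl
    rw [this]
    exact (FiberBundle.continuous_proj F' W).comp (hΦ.continuous.comp
      ((contMDiff_zeroSection (n := ∞) (IB := IB) ℝ V).continuous))
  let P : N → F →L[ℝ] F' := fun n => LinearMap.toContinuousLinearMap
    ((eW.linearMapAt ℝ (f (z n))) ∘ₗ Φ (z n) ∘ₗ (eV.symmₗ ℝ (z n)))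
  let U₁ := U₀ ∩ z ⁻¹' (eV.baseSet ∩ f ⁻¹' eW.baseSet)
  have hU₁ : IsOpen U₁ := hz.continuousOn.isOpen_inter_preimage hU₀
    (eV.open_baseSet.inter (eW.open_baseSet.preimage hf))
  have hPapp : ∀ n ∈ U₁, ∀ v, P n v = (eW ⟨f (z n), Φ (z n) (eV.symm (z n) v)⟩).2 := by
    intro n hn v
    change eW.linearMapAt ℝ _ (Φ (z n) (eV.symmₗ ℝ (z n) v)) = _
    rw [eW.linearMapAt_apply, if_pos (Set.mem_preimage.1 hn.2.2), eV.symmₗ_apply hn.2.1]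
  have hP : ContMDiffOn IN 𝓘(ℝ, F →L[ℝ] F') ∞ P U₁ := by
    refine ContMDiffOn.clm_of_apply fun v => ?_
    have h1 : ContMDiffOn IN (IB.prod 𝓘(ℝ, F)) ∞
        (fun n => (⟨z n, eV.symm (z n) v⟩ : TotalSpace F V)) U₁ := by
      have := (eV.contMDiffOn_symm (n := ∞) (IB := IB)).comp
        ((hz.mono (Set.inter_subset_left)).prodMk (contMDiffOn_const (c := v))) (s := U₁)
        fun n hn => eV.mem_target.2 hn.2.1
      refine this.congr fun n hn => ?_
      exact eV.mk_symm hn.2.1 v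
    have h2 := hΦ.comp_contMDiffOn h1
    have h3 := (eW.contMDiffOn (n := ∞) (IB := IB')).comp h2 fun n hn => eW.mem_source.2 hn.2.2
    exact (contMDiff_snd.comp_contMDiffOn h3).congr fun n hn => hPapp n hn v
  have hn₁ : n₀ ∈ U₁ := ⟨hn₀, heV, heW⟩
  have hPsurj : Function.Surjective (P n₀) := by
    intro w
    obtain ⟨v, hv⟩ := hsurj (eW.symm _ w)
    refine ⟨(eV ⟨z n₀, v⟩).2, ?_⟩
    rw [hPapp n₀ hn₁, eV.symm_apply_apply_mk heV, hv, eW.apply_mk_symm heW]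
  -- `q` is chosen at `n₀` and then kept constant: invertibility of `(P n, q)` is an open condition
  -- on `n`, and inversion is smooth.
  obtain ⟨q, hq⟩ := (P n₀).exists_isInvertible_prod hPsurj
  let T : N → F →L[ℝ] (F' × (Fin k → ℝ)) := fun n => (P n).prod q
  have hT : ContMDiffOn IN 𝓘(ℝ, F →L[ℝ] (F' × (Fin k → ℝ))) ∞ T U₁ := by
    refine ContMDiffOn.clm_of_apply fun v => ?_
    exact (hP.clm_apply contMDiffOn_const).prodMk_space contMDiffOn_const
  let U := U₁ ∩ T ⁻¹' Set.range ((↑) : (F ≃L[ℝ] (F' × (Fin k → ℝ))) → F →L[ℝ] (F' × (Fin k → ℝ)))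
  have hU : IsOpen U := hT.continuousOn.isOpen_inter_preimage hU₁ ContinuousLinearEquiv.isOpen
  refine ⟨U, fun n hn => hn.1.1, hU, ⟨hn₁, hq⟩, q, fun n => (T n).inverse, ?_, fun n hn => ?_⟩
  · intro n hn
    have hi : (T n).IsInvertible := hn.2
    exact ((hi.contDiffAt_map_inverse (n := ∞)).contMDiffAt.comp_contMDiffWithinAt n
      ((hT n hn.1).mono Set.inter_subset_left))
  · have hi : (T n).IsInvertible := hn.2
    refine ⟨hn.1.2.1, hn.1.2.2, fun v => ?_, fun w c => ?_⟩
    · have : T n (eV ⟨z n, v⟩).2 = ((eW ⟨f (z n), Φ (z n) v⟩).2, q (eV ⟨z n, v⟩).2) := by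
        change (P n _, q _) = _
        rw [hPapp n hn.1, eV.symm_apply_apply_mk hn.1.2.1]
      rw [← this, hi.inverse_apply_self]
    · have := hi.self_apply_inverse (w, c)
      rw [← hPapp n hn.1]
      exact ⟨congrArg Prod.fst this, congrArg Prod.snd this⟩

end LocalSplitting

/-! ### Bundle projections as submersions, and lifts from pullback bundles -/

section Submersion

variable {EB : Type*} [NormedAddCommGroup EB] [NormedSpace ℝ EB]
  {HB : Type*} [TopologicalSpace HB] {IB : ModelWithCorners ℝ EB HB}
  {B : Type*} [TopologicalSpace B] [ChartedSpace HB B] [IsManifold IB ∞ B]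
  {F : Type*} [NormedAddCommGroup F] [NormedSpace ℝ F]
  {V : B → Type*} [TopologicalSpace (TotalSpace F V)]
  [∀ b, AddCommGroup (V b)] [∀ b, Module ℝ (V b)] [∀ b, TopologicalSpace (V b)]
  [FiberBundle F V] [VectorBundle ℝ F V] [ContMDiffVectorBundle ∞ F V IB]

/-- The projection of a smooth vector bundle is a submersion. -/
theorem isSubmersion_totalSpace_proj :
    IsSubmersion (IB.prod 𝓘(ℝ, F)) IB ∞ (TotalSpace.proj : TotalSpace F V → B) := by
  -- In bundle charts the projection is `EB × F → EB`, so the complement is the model fibre.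
  refine IsSubmersionOfComplement.isSubmersion (F := F) fun x => ?_
  refine IsSubmersionAtOfComplement.mk_of_continuousAt
    (FiberBundle.continuous_proj F V).continuousAt (ContinuousLinearEquiv.refl ℝ (EB × F))
    (chartAt _ x) (chartAt _ x.proj) (mem_chart_source _ _) (mem_chart_source _ _)
    (IsManifold.chart_mem_maximalAtlas x) (IsManifold.chart_mem_maximalAtlas x.proj) ?_
  intro y hy
  change (extChartAt IB x.proj) ((extChartAt (IB.prod 𝓘(ℝ, F)) x).symm y).proj = y.1
  change y ∈ (extChartAt (IB.prod 𝓘(ℝ, F)) x).target at hy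
  rw [FiberBundle.extChartAt_target] at hy
  have h1 : ((extChartAt (IB.prod 𝓘(ℝ, F)) x).symm y).proj = (extChartAt IB x.proj).symm y.1 := by
    rw [FiberBundle.extChartAt]
    exact (trivializationAt F V x.proj).proj_symm_apply
      ((trivializationAt F V x.proj).mem_target.2 hy.1.2)
  rw [h1]
  exact (extChartAt IB x.proj).right_inv hy.1.1

end Submersion

section PullbackLift

variable {EB : Type*} [NormedAddCommGroup EB] [NormedSpace ℝ EB]
  {HB : Type*} [TopologicalSpace HB] {IB : ModelWithCorners ℝ EB HB}
  {B : Type*} [TopologicalSpace B] [ChartedSpace HB B]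
  {EB' : Type*} [NormedAddCommGroup EB'] [NormedSpace ℝ EB']
  {HB' : Type*} [TopologicalSpace HB'] {IB' : ModelWithCorners ℝ EB' HB'}
  {B' : Type*} [TopologicalSpace B'] [ChartedSpace HB' B']
  {F : Type*} [NormedAddCommGroup F] [NormedSpace ℝ F]
  {V : B → Type*} [TopologicalSpace (TotalSpace F V)]
  [∀ b, AddCommGroup (V b)] [∀ b, Module ℝ (V b)] [∀ b, TopologicalSpace (V b)]
  [FiberBundle F V] [VectorBundle ℝ F V]

theorem contMDiff_pullback_lift (f : C^∞⟮IB', B'; IB, B⟯) :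
    ContMDiff (IB'.prod 𝓘(ℝ, F)) (IB.prod 𝓘(ℝ, F)) ∞
      (Pullback.lift f : TotalSpace F (f *ᵖ V) → TotalSpace F V) := by
  intro x
  have hid := contMDiffAt_totalSpace.1 (contMDiffAt_id (I := IB'.prod 𝓘(ℝ, F)) (n := ∞) (x := x))
  rw [contMDiffAt_totalSpace]
  exact ⟨f.contMDiff.contMDiffAt.comp x hid.1, hid.2⟩

end PullbackLift

noncomputable section

/-! ### Lie algebroid brackets and morphisms -/

section LieAlgebroidBracket

variable {EB : Type*} [NormedAddCommGroup EB] [NormedSpace ℝ EB]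
  {HB : Type*} [TopologicalSpace HB] {IB : ModelWithCorners ℝ EB HB}
  {B : Type*} [TopologicalSpace B] [ChartedSpace HB B] [IsManifold IB ∞ B]
  {F : Type*} [NormedAddCommGroup F] [NormedSpace ℝ F]
  {V : B → Type*} [TopologicalSpace (TotalSpace F V)]
  [∀ b, AddCommGroup (V b)] [∀ b, Module ℝ (V b)] [∀ b, TopologicalSpace (V b)]
  [FiberBundle F V] [VectorBundle ℝ F V]

/-- The product of a smooth function and a smooth section. -/
def ContMDiffSection.mulFun (f : C^∞⟮IB, B; ℝ⟯) (X : Cₛ^∞⟮IB; F, V⟯) : Cₛ^∞⟮IB; F, V⟯ :=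
  ⟨fun b => f b • X b, f.contMDiff.smul_section X.contMDiff⟩

theorem ContMDiffSection.mulFun_apply (f : C^∞⟮IB, B; ℝ⟯) (X : Cₛ^∞⟮IB; F, V⟯) (b : B) :
    ContMDiffSection.mulFun f X b = f b • X b := rfl

theorem ContMDiffSection.sum_apply {ι : Type*} (s : Finset ι) (X : ι → Cₛ^∞⟮IB; F, V⟯) (b : B) :
    (∑ i ∈ s, X i) b = ∑ i ∈ s, X i b := by
  have h := map_sum (ContMDiffSection.coeAddHom IB F ∞ V) X s
  rw [← Finset.sum_apply]
  exact congrFun h b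

namespace LieAlgebroid

variable (L : LieAlgebroid IB F V)

theorem bracket_swap (X Y : Cₛ^∞⟮IB; F, V⟯) : L.bracket X Y = -L.bracket Y X := by
  have h := L.bracket_self (X + Y)
  rw [L.bracket.map_add, LinearMap.add_apply, map_add, map_add, L.bracket_self, L.bracket_self, zero_add,
    add_zero] at h
  exact eq_neg_of_add_eq_zero_left h

theorem bracket_mulFun (X Y : Cₛ^∞⟮IB; F, V⟯) (f : C^∞⟮IB, B; ℝ⟯) (b : B) :
    L.bracket X (.mulFun f Y) b =
      f b • L.bracket X Y b + derivAlong IB f b (L.anchor b (X b)) • Y b :=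
  L.leibniz X Y _ f (ContMDiffSection.mulFun_apply f Y) b

theorem mulFun_bracket (X Y : Cₛ^∞⟮IB; F, V⟯) (f : C^∞⟮IB, B; ℝ⟯) (b : B) :
    L.bracket (.mulFun f X) Y b =
      f b • L.bracket X Y b - derivAlong IB f b (L.anchor b (Y b)) • X b := by
  rw [L.bracket_swap _ Y, L.bracket_swap X Y, ContMDiffSection.coe_neg, Pi.neg_apply,
    L.bracket_mulFun, ContMDiffSection.coe_neg, Pi.neg_apply, smul_neg]
  abel

theorem bracket_sum {ι : Type*} (s : Finset ι) (X : Cₛ^∞⟮IB; F, V⟯) (Y : ι → Cₛ^∞⟮IB; F, V⟯)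
    (b : B) : L.bracket X (∑ i ∈ s, Y i) b = ∑ i ∈ s, L.bracket X (Y i) b := by
  rw [map_sum, ContMDiffSection.sum_apply]

theorem sum_bracket {ι : Type*} (s : Finset ι) (X : ι → Cₛ^∞⟮IB; F, V⟯) (Y : Cₛ^∞⟮IB; F, V⟯)
    (b : B) : L.bracket (∑ i ∈ s, X i) Y b = ∑ i ∈ s, L.bracket (X i) Y b := by
  rw [map_sum, LinearMap.sum_apply, ContMDiffSection.sum_apply]

variable {EB' : Type*} [NormedAddCommGroup EB'] [NormedSpace ℝ EB']
  {HB' : Type*} [TopologicalSpace HB'] {IB' : ModelWithCorners ℝ EB' HB'}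
  {B' : Type*} [TopologicalSpace B'] [ChartedSpace HB' B'] [IsManifold IB' ∞ B']
  {F' : Type*} [NormedAddCommGroup F'] [NormedSpace ℝ F']
  {W : B' → Type*} [TopologicalSpace (TotalSpace F' W)]
  [∀ b, AddCommGroup (W b)] [∀ b, Module ℝ (W b)] [∀ b, TopologicalSpace (W b)]
  [FiberBundle F' W] [VectorBundle ℝ F' W]
  (LW : LieAlgebroid IB' F' W) {f : B → B'} {φ : (b : B) → V b →ₗ[ℝ] W (f b)}

/-- If near `b` the section `Y` of `ker φ` is a combination of sections of `ker φ` whose bracket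
with `S` is in `ker φ` at `b`, then `[S, Y]` is in `ker φ` at `b`. -/
theorem map_bracket_eq_zero_of_sum {S Y : Cₛ^∞⟮IB; F, V⟯} {b : B} {u : C^∞⟮IB, B; ℝ⟯} (hu : u b = 1)
    {n : ℕ} {g : Fin n → C^∞⟮IB, B; ℝ⟯} {K : Fin n → Cₛ^∞⟮IB; F, V⟯}
    (hY : ∀ b, u b • Y b = ∑ l, g l b • K l b) (hφY : φ b (Y b) = 0) (hφK : ∀ l, φ b (K l b) = 0)
    (hSK : ∀ l, φ b (L.bracket S (K l) b) = 0) : φ b (L.bracket S Y b) = 0 := by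
  have h : ContMDiffSection.mulFun u Y = ∑ l, ContMDiffSection.mulFun (g l) (K l) := by
    ext b
    rw [ContMDiffSection.sum_apply]
    exact hY b
  have h1 := congrArg (φ b) (L.bracket_mulFun S Y u b)
  -- The derivative terms of the Leibniz rule multiply `Y b` and `K l b`, which `φ` kills; hence
  -- only the value `u b = 1` matters.
  rw [h, L.bracket_sum, map_sum, map_add, map_smul, map_smul, hφY, hu, one_smul, smul_zero,
    add_zero] at h1
  rw [← h1]
  refine Finset.sum_eq_zero fun l _ => ?_
  rw [L.bracket_mulFun, map_add, map_smul, map_smul, hSK, hφK, smul_zero, smul_zero, add_zero]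

-- Modulo the Leibniz rule the bracket condition is bilinear over functions. Subtracting `∑ uᵢ
-- hor(aᵢ)` from `X` and `∑ vⱼ hor(cⱼ)` from `Y` leaves sections of the kernel, so the condition
-- need only be known for brackets of two lifts, of a lift and a kernel section, and of two kernel
-- sections.
variable {LW} in
theorem map_bracket_eq_sum_of_lift (hor : Cₛ^∞⟮IB'; F', W⟯ → Cₛ^∞⟮IB; F, V⟯)
    (hφ : ∀ a b, φ b (hor a b) = a (f b))
    (hhor : ∀ a c b, φ b (L.bracket (hor a) (hor c) b) = LW.bracket a c (f b))
    (hker : ∀ (a : Cₛ^∞⟮IB'; F', W⟯) (Y : Cₛ^∞⟮IB; F, V⟯), (∀ b, φ b (Y b) = 0) →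
      ∀ b, φ b (L.bracket (hor a) Y b) = 0)
    (hkk : ∀ X Y : Cₛ^∞⟮IB; F, V⟯, (∀ b, φ b (X b) = 0) → (∀ b, φ b (Y b) = 0) →
      ∀ b, φ b (L.bracket X Y b) = 0)
    (X Y : Cₛ^∞⟮IB; F, V⟯) (k l : ℕ)
    (u : Fin k → C^∞⟮IB, B; ℝ⟯) (a : Fin k → Cₛ^∞⟮IB'; F', W⟯)
    (v : Fin l → C^∞⟮IB, B; ℝ⟯) (c : Fin l → Cₛ^∞⟮IB'; F', W⟯)
    (hX : ∀ b, φ b (X b) = ∑ i, u i b • a i (f b))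
    (hY : ∀ b, φ b (Y b) = ∑ j, v j b • c j (f b)) (b : B) :
    φ b (L.bracket X Y b) =
      ∑ i, ∑ j, (u i b * v j b) • LW.bracket (a i) (c j) (f b)
      + ∑ j, derivAlong IB (v j) b (L.anchor b (X b)) • c j (f b)
      - ∑ i, derivAlong IB (u i) b (L.anchor b (Y b)) • a i (f b) := by
  obtain ⟨X', rfl⟩ : ∃ X', X = ∑ i, .mulFun (u i) (hor (a i)) + X' :=
    ⟨X - ∑ i, .mulFun (u i) (hor (a i)), (add_sub_cancel _ _).symm⟩
  obtain ⟨Y', rfl⟩ : ∃ Y', Y = ∑ j, .mulFun (v j) (hor (c j)) + Y' :=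
    ⟨Y - ∑ j, .mulFun (v j) (hor (c j)), (add_sub_cancel _ _).symm⟩
  have hX' : ∀ b, φ b (X' b) = 0 := fun b => by
    have := hX b
    rw [ContMDiffSection.coe_add, Pi.add_apply, map_add, ContMDiffSection.sum_apply, map_sum] at this
    simp only [ContMDiffSection.mulFun_apply, map_smul, hφ] at this
    exact left_eq_add.1 this.symm
  have hY' : ∀ b, φ b (Y' b) = 0 := fun b => by
    have := hY b
    rw [ContMDiffSection.coe_add, Pi.add_apply, map_add, ContMDiffSection.sum_apply, map_sum] at this
    simp only [ContMDiffSection.mulFun_apply, map_smul, hφ] at this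
    exact left_eq_add.1 this.symm
  have hswap : ∀ (Z : Cₛ^∞⟮IB; F, V⟯) (c : Cₛ^∞⟮IB'; F', W⟯), (∀ b, φ b (Z b) = 0) →
      φ b (L.bracket Z (hor c) b) = 0 := fun Z c hZ => by
    rw [L.bracket_swap, ContMDiffSection.coe_neg, Pi.neg_apply, map_neg, hker c Z hZ, neg_zero]
  set X := ∑ i, ContMDiffSection.mulFun (u i) (hor (a i)) + X' with hXdef
  have h1 : ∀ c, φ b (L.bracket X (hor c) b) = ∑ i, (u i b • LW.bracket (a i) c (f b)
      - derivAlong IB (u i) b (L.anchor b (hor c b)) • a i (f b)) := fun c => by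
    rw [hXdef, map_add, LinearMap.add_apply, ContMDiffSection.coe_add, Pi.add_apply, map_add,
      hswap _ _ hX', add_zero, L.sum_bracket, map_sum]
    simp only [L.mulFun_bracket, map_sub, map_smul, hφ, hhor]
  have h2 : φ b (L.bracket X Y' b) =
      -∑ i, derivAlong IB (u i) b (L.anchor b (Y' b)) • a i (f b) := by
    rw [hXdef, map_add, LinearMap.add_apply, ContMDiffSection.coe_add, Pi.add_apply, map_add,
      hkk _ _ hX' hY', add_zero, L.sum_bracket, map_sum, ← Finset.sum_neg_distrib]
    simp only [L.mulFun_bracket, map_sub, map_smul, hφ, hker _ _ hY', smul_zero, zero_sub]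
  -- The derivatives of `uᵢ` along `vⱼ hor(cⱼ)` (from `h1`) and along `Y'` (from `h2`) add up to the
  -- derivative along `Y` in the goal.
  have h3 : ∀ i, derivAlong IB (u i) b
      (L.anchor b ((∑ j, ContMDiffSection.mulFun (v j) (hor (c j)) + Y') b)) =
      ∑ j, v j b * derivAlong IB (u i) b (L.anchor b (hor (c j) b)) +
        derivAlong IB (u i) b (L.anchor b (Y' b)) := fun i => by
    rw [ContMDiffSection.coe_add, Pi.add_apply, ContMDiffSection.sum_apply, map_add, map_sum]
    simp only [ContMDiffSection.mulFun_apply, map_smul, derivAlong]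
    erw [map_add, map_sum]
    simp only [map_smul]
    rfl
  rw [map_add, ContMDiffSection.coe_add, Pi.add_apply, map_add, h2, L.bracket_sum, map_sum]
  simp only [L.bracket_mulFun, map_add, map_smul, hφ, h1, h3, Finset.sum_add_distrib, add_smul,
    Finset.sum_sub_distrib, smul_sub, Finset.smul_sum, Finset.sum_smul, smul_smul]
  rw [Finset.sum_comm, Finset.sum_comm (f := fun j i => (v j b *
    derivAlong IB (u i) b (L.anchor b (hor (c j) b))) • a i (f b))]
  simp only [mul_comm (v _ b)]
  abel

end LieAlgebroid

end LieAlgebroidBracket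

/-! ### Integral curves of linear vector fields -/

section IntegralCurve

variable {EN : Type*} [NormedAddCommGroup EN] [NormedSpace ℝ EN] [CompleteSpace EN]
  {HN : Type*} [TopologicalSpace HN] {I : ModelWithCorners ℝ EN HN}
  {N : Type*} [TopologicalSpace N] [ChartedSpace HN N] [IsManifold I 1 N]
  {v : (x : N) → TangentSpace I x} {x₀ : N}

/-- The integral curves of a `C¹` vector field that start near a given point exist for a uniform
time. -/
theorem exists_isMIntegralCurveOn_Ioo_nhds [BoundarylessManifold I N]
    (hv : ContMDiffAt I I.tangent 1 (fun x => (⟨x, v x⟩ : TangentBundle I N)) x₀) :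
    ∃ U ∈ 𝓝 x₀, ∃ ε > 0, ∀ x ∈ U, ∃ γ : ℝ → N, γ 0 = x ∧
      IsMIntegralCurveOn γ v (Set.Ioo (-ε) ε) := by
  have hx : I.IsInteriorPoint x₀ := BoundarylessManifold.isInteriorPoint
  rw [contMDiffAt_iff] at hv
  obtain ⟨ε, hε, a, r, _, _, hr, hpl⟩ := IsPicardLindelof.of_contDiffAt_one
    (hv.2.contDiffAt (range_mem_nhds_isInteriorPoint hx)).snd
  obtain ⟨α, hα, hαc⟩ := (hpl 0).exists_forall_mem_closedBall_eq_hasDerivWithinAt_continuousOn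
  simp only [zero_sub, zero_add] at hα hαc
  set y₀ := extChartAt I x₀ x₀ with hy₀
  have hb : Metric.closedBall y₀ (r : ℝ) ∈ 𝓝 y₀ := Metric.closedBall_mem_nhds _ hr
  have hi : Set.Icc (-ε) ε ∈ 𝓝 (0 : ℝ) := Icc_mem_nhds (neg_lt_zero.2 hε) hε
  have hα0 : α (y₀, 0) = y₀ := (hα _ (mem_of_mem_nhds hb)).1
  have hc : ContinuousAt α (y₀, 0) := hαc.continuousAt (prod_mem_nhds hb hi)
  -- Joint continuity of the local flow in point and time keeps all nearby curves inside the chart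
  -- for a common time.
  have htarget : α ⁻¹' interior (extChartAt I x₀).target ∈ 𝓝 (y₀, (0 : ℝ)) := by
    refine hc (isOpen_interior.mem_nhds ?_)
    rw [hα0]
    exact I.isInteriorPoint_iff.1 hx
  obtain ⟨W, hW, J, hJ, hWJ⟩ := mem_nhds_prod_iff.1 htarget
  obtain ⟨δ, hδ, hδJ⟩ := Metric.mem_nhds_iff.1 hJ
  refine ⟨extChartAt I x₀ ⁻¹' (W ∩ Metric.closedBall y₀ r) ∩ (extChartAt I x₀).source,
    Filter.inter_mem ((continuousAt_extChartAt x₀) (Filter.inter_mem hW hb))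
      (extChartAt_source_mem_nhds x₀), min δ ε, lt_min hδ hε, fun x hxU => ?_⟩
  let f : ℝ → EN := fun t => α (extChartAt I x₀ x, t)
  refine ⟨(extChartAt I x₀).symm ∘ f, ?_, fun t ht => ?_⟩
  · change (extChartAt I x₀).symm (α (extChartAt I x₀ x, 0)) = x
    rw [(hα _ hxU.1.2).1, (extChartAt I x₀).left_inv hxU.2]
  have htε : t ∈ Set.Ioo (-ε) ε :=
    ⟨(neg_le_neg (min_le_right _ _)).trans_lt ht.1, ht.2.trans_le (min_le_right _ _)⟩
  have hf3 : f t ∈ interior (extChartAt I x₀).target := by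
    refine hWJ ⟨hxU.1.1, hδJ ?_⟩
    rw [Real.ball_eq_Ioo, zero_sub, zero_add]
    exact ⟨(neg_le_neg (min_le_left _ _)).trans_lt ht.1, ht.2.trans_le (min_le_left _ _)⟩
  let xₜ : N := (extChartAt I x₀).symm (f t)
  have h : HasDerivAt f (x := t) <| fderivWithin ℝ (extChartAt I x₀ ∘ (extChartAt I xₜ).symm)
      (Set.range I) (extChartAt I xₜ xₜ) (v xₜ) :=
    ((hα _ hxU.1.2).2 t (Set.Ioo_subset_Icc_self htε)).hasDerivAt (Icc_mem_nhds htε.1 htε.2)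
  rw [← tangentCoordChange_def] at h
  have hf3' := interior_subset hf3
  have hft1 : xₜ ∈ (extChartAt I x₀).source := (extChartAt I x₀).map_target hf3'
  have hft2 := mem_extChartAt_source (I := I) xₜ
  -- The flow equation is written in the chart at `x₀`, while an integral curve is tested in the
  -- chart at its current point `xₜ`; this transfers the derivative.
  have key : ∀ w : EN, HasDerivAt f (tangentCoordChange I xₜ x₀ xₜ w) t →
      HasDerivAt ((extChartAt I xₜ ∘ (extChartAt I x₀).symm) ∘ f) w t := fun w h => by
    rw [← tangentCoordChange_self (I := I) (x := xₜ) (z := xₜ) (v := w) hft2,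
      ← tangentCoordChange_comp (x := x₀) ⟨⟨hft2, hft1⟩, hft2⟩]
    apply HasFDerivAt.comp_hasDerivAt _ _ h
    apply HasFDerivWithinAt.hasFDerivAt (s := Set.range I) _ <|
      mem_nhds_iff.mpr ⟨interior (extChartAt I x₀).target,
        subset_trans interior_subset (extChartAt_target_subset_range ..),
        isOpen_interior, hf3⟩
    rw [← (extChartAt I x₀).right_inv hf3']
    exact hasFDerivWithinAt_tangentCoordChange ⟨hft1, hft2⟩
  have hγ : HasMFDerivAt 𝓘(ℝ, ℝ) I ((extChartAt I x₀).symm ∘ f) t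
      (ContinuousLinearMap.toSpanSingleton ℝ (v xₜ)) :=
    ⟨(continuousAt_extChartAt_symm'' hf3').comp h.continuousAt,
      (key _ h).hasFDerivAt.hasFDerivWithinAt⟩
  rw [← ContinuousLinearMap.smulRight_one_eq_toSpanSingleton] at hγ
  exact hγ.hasMFDerivWithinAt

variable [T2Space N] [BoundarylessManifold I N]

/-- Integral curves over a compact time interval extend as long as their end points start integral
curves of a uniform length. -/
theorem exists_isMIntegralCurveOn_Ioo_of_uniform
    (hv : ContMDiff I I.tangent 1 (fun x => (⟨x, v x⟩ : TangentBundle I N))) {x : N} {ε T : ℝ}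
    (hε : 0 < ε) (h0 : ∃ γ : ℝ → N, γ 0 = x ∧ IsMIntegralCurveOn γ v (Set.Ioo (-ε) ε))
    (h : ∀ (γ : ℝ → N) (s : ℝ), γ 0 = x → IsMIntegralCurveOn γ v (Set.Ioo (-s) s) →
      ∀ t ∈ Set.Ioo (-s) s, |t| ≤ T →
        ∃ γ' : ℝ → N, γ' 0 = γ t ∧ IsMIntegralCurveOn γ' v (Set.Ioo (-ε) ε)) :
    ∃ γ : ℝ → N, γ 0 = x ∧ IsMIntegralCurveOn γ v (Set.Ioo (-T) T) := by
  -- Each step gains `ε / 2` on both sides until `T` is reached; the minimum lets the process stop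
  -- there, where `h` no longer applies.
  have key : ∀ n : ℕ, ∃ s, ε ≤ s ∧ min T (n * (ε / 2)) ≤ s ∧
      ∃ γ : ℝ → N, γ 0 = x ∧ IsMIntegralCurveOn γ v (Set.Ioo (-s) s) := by
    intro n
    induction n with
    | zero => exact ⟨ε, le_rfl, (min_le_right _ _).trans (by simpa using hε.le), h0⟩
    | succ n ih =>
      obtain ⟨s, hs, hns, γ, hγ0, hγ⟩ := ih
      rcases le_or_gt T s with hT | hT
      · exact ⟨s, hs, (min_le_left _ _).trans hT, γ, hγ0, hγ⟩
      have hn : n * (ε / 2) ≤ s := (min_le_iff.1 hns).resolve_left (not_le.2 hT)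
      -- Curves of length `ε` started at `±t₀` reach `±(s + ε / 2)` and overlap the given curve, so
      -- they can be glued to it.
      set t₀ := s - ε / 2 with ht₀
      have ht₀T : |t₀| ≤ T := by rw [abs_of_nonneg] <;> linarith
      obtain ⟨γ₁', h₁', hγ₁⟩ := h γ s hγ0 hγ (-t₀) ⟨by linarith, by linarith⟩ (by rwa [abs_neg])
      rw [← isMIntegralCurveOn_comp_add (dt := t₀)] at hγ₁
      set γ₁ := γ₁' ∘ (· + t₀) with γ₁_def
      have heq₁ : γ₁ (-t₀) = γ (-t₀) := by simp [γ₁_def, h₁']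
      obtain ⟨γ₂', h₂', hγ₂⟩ := h γ s hγ0 hγ t₀ ⟨by linarith, by linarith⟩ ht₀T
      rw [← isMIntegralCurveOn_comp_sub (dt := t₀)] at hγ₂
      set γ₂ := γ₂' ∘ (· - t₀) with γ₂_def
      have heq₂ : γ₂ t₀ = γ t₀ := by simp [γ₂_def, h₂']
      simp_rw [Set.mem_Ioo, ← sub_lt_iff_lt_add, ← lt_sub_iff_add_lt, ← Set.mem_Ioo] at hγ₁
      simp_rw [Set.mem_Ioo, lt_sub_iff_add_lt, sub_lt_iff_lt_add, ← Set.mem_Ioo] at hγ₂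
      refine ⟨s + ε / 2, by linarith, (min_le_right _ _).trans (by push_cast; linarith),
        (Set.Ioo (-(s + ε / 2)) s).piecewise ((Set.Ioo (-s) s).piecewise γ γ₁) γ₂, ?_, ?_⟩
      · rw [Set.piecewise, if_pos ⟨by linarith, by linarith⟩, Set.piecewise,
          if_pos ⟨by linarith, by linarith⟩, hγ0]
      · apply (isMIntegralCurveOn_piecewise (t₀ := t₀) hv _ hγ₂
          ⟨⟨by linarith, by linarith⟩, ⟨by linarith, by linarith⟩⟩
          (by rw [Set.piecewise, if_pos ⟨by linarith, by linarith⟩, ← heq₂])).mono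
          (Set.Ioo_subset_Ioo_union_Ioo le_rfl (by linarith) (by linarith))
        exact (isMIntegralCurveOn_piecewise (t₀ := -t₀) hv hγ hγ₁
          ⟨⟨by linarith, by linarith⟩, ⟨by linarith, by linarith⟩⟩ heq₁.symm).mono
          (Set.union_comm _ _ ▸ Set.Ioo_subset_Ioo_union_Ioo (by linarith) (by linarith) le_rfl)
  obtain ⟨n, hn⟩ := exists_nat_ge (T / (ε / 2))
  obtain ⟨s, -, hs, γ, hγ0, hγ⟩ := key n
  have hTs : T ≤ s := by
    rwa [min_eq_left ((div_le_iff₀ (half_pos hε)).1 hn)] at hs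
  exact ⟨γ, hγ0, hγ.mono (Set.Ioo_subset_Ioo (neg_le_neg hTs) hTs)⟩

end IntegralCurve

/-! ### Related vector fields, and completeness of homogeneous vector fields -/

section RelatedVectorFields

variable {EN : Type*} [NormedAddCommGroup EN] [NormedSpace ℝ EN]
  {HN : Type*} [TopologicalSpace HN] {I : ModelWithCorners ℝ EN HN}
  {N : Type*} [TopologicalSpace N] [ChartedSpace HN N]
  {EN' : Type*} [NormedAddCommGroup EN'] [NormedSpace ℝ EN']
  {HN' : Type*} [TopologicalSpace HN'] {I' : ModelWithCorners ℝ EN' HN'}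
  {N' : Type*} [TopologicalSpace N'] [ChartedSpace HN' N']
  {w : (x : N') → TangentSpace I' x} {v : (x : N) → TangentSpace I x}

/-- A map relating two vector fields maps integral curves to integral curves. -/
theorem IsMIntegralCurveOn.map {γ : ℝ → N} {s : Set ℝ} (hγ : IsMIntegralCurveOn γ v s) {g : N → N'}
    (hg : MDifferentiable I I' g) (h : ∀ x, mfderiv I I' g x (v x) = w (g x)) :
    IsMIntegralCurveOn (g ∘ γ) w s := fun t ht => by
  have h1 := (hg (γ t)).hasMFDerivAt.comp_hasMFDerivWithinAt t (hγ t ht)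
  have h2 : (mfderiv I I' g (γ t)).comp ((1 : ℝ →L[ℝ] ℝ).smulRight (v (γ t))) =
      (1 : ℝ →L[ℝ] ℝ).smulRight (w (g (γ t))) := by
    rw [← h]
    ext
    simp
  exact h2 ▸ h1

end RelatedVectorFields

section LinearVectorField

variable {EM : Type*} [NormedAddCommGroup EM] [NormedSpace ℝ EM] [FiniteDimensional ℝ EM]
  {M : Type*} [TopologicalSpace M] [ChartedSpace EM M] [IsManifold 𝓘(ℝ, EM) ∞ M]
  {FE : Type*} [NormedAddCommGroup FE] [NormedSpace ℝ FE] [FiniteDimensional ℝ FE]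
  {E : M → Type*} [TopologicalSpace (TotalSpace FE E)]
  [∀ m, AddCommGroup (E m)] [∀ m, Module ℝ (E m)] [∀ m, TopologicalSpace (E m)]
  [FiberBundle FE E] [VectorBundle ℝ FE E] [ContMDiffVectorBundle ∞ FE E 𝓘(ℝ, EM)]
  {Z : (e : TotalSpace FE E) → TangentSpace (𝓘(ℝ, EM).prod 𝓘(ℝ, FE)) e}
  {Y : (m : M) → TangentSpace 𝓘(ℝ, EM) m}

theorem contMDiff_fibreSMul (t : ℝ) : ContMDiff (𝓘(ℝ, EM).prod 𝓘(ℝ, FE)) (𝓘(ℝ, EM).prod 𝓘(ℝ, FE)) ∞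
    (fibreSMul t : TotalSpace FE E → TotalSpace FE E) := fun _ =>
  contMDiffAt_const.fibreSMul contMDiffAt_id

/-- A homogeneous vector field on a vector bundle has integral curves for a uniform time along the
fibres near a given point. -/
theorem exists_isMIntegralCurveOn_Ioo_of_homogeneous
    (hZ : ContMDiff (𝓘(ℝ, EM).prod 𝓘(ℝ, FE)) (𝓘(ℝ, EM).prod 𝓘(ℝ, FE)).tangent 1
      (fun e => (⟨e, Z e⟩ : TangentBundle (𝓘(ℝ, EM).prod 𝓘(ℝ, FE)) (TotalSpace FE E))))
    (hsmul : ∀ (t : ℝ) (e : TotalSpace FE E), mfderiv (𝓘(ℝ, EM).prod 𝓘(ℝ, FE))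
      (𝓘(ℝ, EM).prod 𝓘(ℝ, FE)) (fibreSMul t) e (Z e) = Z (fibreSMul t e)) (m₀ : M) :
    ∃ U ∈ 𝓝 m₀, ∃ ε > 0, ∀ e : TotalSpace FE E, e.proj ∈ U → ∃ γ : ℝ → TotalSpace FE E, γ 0 = e ∧
      IsMIntegralCurveOn γ Z (Set.Ioo (-ε) ε) := by
  have : CompleteSpace EM := FiniteDimensional.complete ℝ EM
  have : CompleteSpace FE := FiniteDimensional.complete ℝ FE
  have : IsManifold (𝓘(ℝ, EM).prod 𝓘(ℝ, FE)) 1 (TotalSpace FE E) :=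
    IsManifold.of_le (n := ∞) (mod_cast le_top)
  obtain ⟨W, hW, ε, hε, hWε⟩ := exists_isMIntegralCurveOn_Ioo_nhds (hZ (⟨m₀, 0⟩ : TotalSpace FE E))
  let τ := trivializationAt FE E m₀
  have hm₀ : m₀ ∈ τ.baseSet := FiberBundle.mem_baseSet_trivializationAt FE E m₀
  have hτ0 : τ ⟨m₀, 0⟩ = (m₀, 0) := Prod.ext (τ.coe_fst' hm₀) (τ.linear ℝ hm₀).map_zero
  have hW' : {y | τ.toOpenPartialHomeomorph.symm y ∈ W} ∈ 𝓝 (m₀, (0 : FE)) := by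
    have hs : (⟨m₀, 0⟩ : TotalSpace FE E) ∈ τ.source := τ.mem_source.2 hm₀
    have hc := τ.toOpenPartialHomeomorph.continuousAt_symm
      (τ.toOpenPartialHomeomorph.map_source hs)
    have hl : τ.toOpenPartialHomeomorph.symm (τ ⟨m₀, 0⟩) = ⟨m₀, 0⟩ :=
      τ.toOpenPartialHomeomorph.left_inv hs
    change ContinuousAt _ (τ ⟨m₀, 0⟩) at hc
    rw [hτ0] at hc hl
    rw [ContinuousAt, hl] at hc
    exact hc hW
  obtain ⟨U, hU, R, hR, hUR⟩ := mem_nhds_prod_iff.1 hW'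
  refine ⟨U ∩ τ.baseSet, Filter.inter_mem hU (τ.open_baseSet.mem_nhds hm₀), ε, hε, fun e he => ?_⟩
  -- `e` is scaled by a small `s > 0` into the neighbourhood of the zero vector, flowed there for
  -- time `ε`, and scaled back; by homogeneity the result is an integral curve for the same time.
  obtain ⟨s, hsR, hs0⟩ : ∃ s : ℝ, s • (τ e).2 ∈ R ∧ 0 < s := by
    have hc : Filter.Tendsto (fun s : ℝ => s • (τ e).2) (𝓝[>] 0) (𝓝 0) := by
      have : Continuous fun s : ℝ => s • (τ e).2 := by fun_prop
      simpa using (this.tendsto 0).mono_left (nhdsWithin_le_nhds (s := Set.Ioi 0))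
    exact ((hc.eventually hR).and self_mem_nhdsWithin).exists
  have hse : fibreSMul s e ∈ W := by
    have hsrc : fibreSMul s e ∈ τ.source := τ.mem_source.2 he.2
    have h1 : τ (fibreSMul s e) = (e.proj, s • (τ e).2) :=
      Prod.ext (τ.coe_fst hsrc) ((τ.linear ℝ he.2).map_smul s e.snd)
    have h2 : τ.toOpenPartialHomeomorph.symm (τ (fibreSMul s e)) = fibreSMul s e :=
      τ.toOpenPartialHomeomorph.left_inv hsrc
    rw [← h2, h1]
    exact hUR ⟨he.1, hsR⟩
  obtain ⟨γ, hγ0, hγ⟩ := hWε _ hse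
  refine ⟨fibreSMul s⁻¹ ∘ γ, ?_,
    hγ.map ((contMDiff_fibreSMul s⁻¹).mdifferentiable (by simp)) (hsmul s⁻¹)⟩
  change fibreSMul s⁻¹ (γ 0) = e
  rw [hγ0]
  change (⟨e.proj, s⁻¹ • s • e.snd⟩ : TotalSpace FE E) = e
  rw [inv_smul_smul₀ hs0.ne']

/-- A homogeneous vector field on a vector bundle is complete if it projects to a complete vector
field on the base. -/
theorem IsCompleteVectorField.of_homogeneous [T2Space M]
    (hZ : ContMDiff (𝓘(ℝ, EM).prod 𝓘(ℝ, FE)) (𝓘(ℝ, EM).prod 𝓘(ℝ, FE)).tangent 1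
      (fun e => (⟨e, Z e⟩ : TangentBundle (𝓘(ℝ, EM).prod 𝓘(ℝ, FE)) (TotalSpace FE E))))
    (hsmul : ∀ (t : ℝ) (e : TotalSpace FE E), mfderiv (𝓘(ℝ, EM).prod 𝓘(ℝ, FE))
      (𝓘(ℝ, EM).prod 𝓘(ℝ, FE)) (fibreSMul t) e (Z e) = Z (fibreSMul t e))
    (hY : ContMDiff 𝓘(ℝ, EM) 𝓘(ℝ, EM).tangent 1
      (fun m => (⟨m, Y m⟩ : TangentBundle 𝓘(ℝ, EM) M)))
    (hZY : ∀ e : TotalSpace FE E, mfderiv (𝓘(ℝ, EM).prod 𝓘(ℝ, FE)) 𝓘(ℝ, EM)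
      (TotalSpace.proj : TotalSpace FE E → M) e (Z e) = Y e.proj)
    (hYc : IsCompleteVectorField 𝓘(ℝ, EM) Y) :
    IsCompleteVectorField (𝓘(ℝ, EM).prod 𝓘(ℝ, FE)) Z := by
  have : CompleteSpace EM := FiniteDimensional.complete ℝ EM
  have : CompleteSpace FE := FiniteDimensional.complete ℝ FE
  have : IsManifold (𝓘(ℝ, EM).prod 𝓘(ℝ, FE)) 1 (TotalSpace FE E) :=
    IsManifold.of_le (n := ∞) (mod_cast le_top)
  have : IsManifold 𝓘(ℝ, EM) 1 M := IsManifold.of_le (n := ∞) (mod_cast le_top)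
  have : T2Space (TotalSpace FE E) := FiberBundle.t2Space_totalSpace
  intro e
  obtain ⟨c, hc0, hc⟩ := hYc e.proj
  rw [exists_isMIntegralCurve_iff_exists_isMIntegralCurveOn_Ioo hZ]
  intro T
  -- Compactness of this piece of the base curve makes the local existence times uniform. The
  -- absolute value covers negative `T`.
  have hK : IsCompact (c '' Set.Icc (-|T|) |T|) := isCompact_Icc.image hc.continuous
  obtain ⟨ε, hε, hKε⟩ : ∃ ε > 0, ∀ e : TotalSpace FE E, e.proj ∈ c '' Set.Icc (-|T|) |T| →
      ∃ γ : ℝ → TotalSpace FE E, γ 0 = e ∧ IsMIntegralCurveOn γ Z (Set.Ioo (-ε) ε) := by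
    refine hK.induction_on (p := fun K => ∃ ε > 0, ∀ e : TotalSpace FE E, e.proj ∈ K →
      ∃ γ : ℝ → TotalSpace FE E, γ 0 = e ∧ IsMIntegralCurveOn γ Z (Set.Ioo (-ε) ε))
      ⟨1, one_pos, fun _ h => h.elim⟩ ?_ ?_ ?_
    · rintro K K' hKK' ⟨ε, hε, h⟩
      exact ⟨ε, hε, fun e he => h e (hKK' he)⟩
    · rintro K K' ⟨ε, hε, h⟩ ⟨ε', hε', h'⟩
      refine ⟨min ε ε', lt_min hε hε', fun e he => ?_⟩
      rcases he with he | he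
      · obtain ⟨γ, hγ0, hγ⟩ := h e he
        exact ⟨γ, hγ0, hγ.mono
          (Set.Ioo_subset_Ioo (neg_le_neg (min_le_left _ _)) (min_le_left _ _))⟩
      · obtain ⟨γ, hγ0, hγ⟩ := h' e he
        exact ⟨γ, hγ0, hγ.mono
          (Set.Ioo_subset_Ioo (neg_le_neg (min_le_right _ _)) (min_le_right _ _))⟩
    · intro m _
      obtain ⟨U, hU, h⟩ := exists_isMIntegralCurveOn_Ioo_of_homogeneous hZ hsmul m
      exact ⟨U, mem_nhdsWithin_of_mem_nhds hU, h⟩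
  obtain ⟨γ, hγ0, hγ⟩ := exists_isMIntegralCurveOn_Ioo_of_uniform (x := e) (T := |T|) hZ hε
    (hKε e ⟨0, ⟨neg_nonpos.2 (abs_nonneg T), abs_nonneg T⟩, hc0⟩) fun γ s hγ0 hγ t ht htT => by
      have h0 : (0 : ℝ) ∈ Set.Ioo (-s) s := by
        constructor <;> linarith [ht.1, ht.2]
      have hp := hγ.map (w := Y) ((contMDiff_proj (n := ∞) (IB := 𝓘(ℝ, EM)) E).mdifferentiable
        (by simp)) hZY
      -- By uniqueness a curve of `Z` from `e` lies over `c`, hence its points up to time `|T|` lie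
      -- over the compact set.
      have heq := isMIntegralCurveOn_Ioo_eqOn_of_contMDiff_boundaryless h0 hY hp
        (hc.isMIntegralCurveOn _) (by rw [Function.comp_apply, hγ0, hc0]) ht
      exact hKε _ ⟨t, abs_le.1 htT, heq.symm⟩
  exact ⟨γ, hγ0, hγ.mono (Set.Ioo_subset_Ioo (neg_le_neg (le_abs_self T)) (le_abs_self T))⟩

end LinearVectorField

/-! ### Algebra of double vector bundles -/

namespace DoubleVectorBundle

variable {EM : Type*} [NormedAddCommGroup EM] [NormedSpace ℝ EM]
  {M : Type*} [TopologicalSpace M] [ChartedSpace EM M]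
  {FA : Type*} [NormedAddCommGroup FA] [NormedSpace ℝ FA]
  {A : M → Type*} [TopologicalSpace (TotalSpace FA A)]
  [∀ m, AddCommGroup (A m)] [∀ m, Module ℝ (A m)] [∀ m, TopologicalSpace (A m)]
  [FiberBundle FA A] [VectorBundle ℝ FA A]
  {FE : Type*} [NormedAddCommGroup FE] [NormedSpace ℝ FE]
  {E : M → Type*} [TopologicalSpace (TotalSpace FE E)]
  [∀ m, AddCommGroup (E m)] [∀ m, Module ℝ (E m)] [∀ m, TopologicalSpace (E m)]
  [FiberBundle FE E] [VectorBundle ℝ FE E]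
  {F₁ : Type*} [NormedAddCommGroup F₁] [NormedSpace ℝ F₁]
  {D₁ : TotalSpace FE E → Type*} [TopologicalSpace (TotalSpace F₁ D₁)]
  [∀ e, AddCommGroup (D₁ e)] [∀ e, Module ℝ (D₁ e)] [∀ e, TopologicalSpace (D₁ e)]
  [FiberBundle F₁ D₁] [VectorBundle ℝ F₁ D₁]
  {F₂ : Type*} [NormedAddCommGroup F₂] [NormedSpace ℝ F₂]
  {D₂ : TotalSpace FA A → Type*} [TopologicalSpace (TotalSpace F₂ D₂)]
  [∀ a, AddCommGroup (D₂ a)] [∀ a, Module ℝ (D₂ a)] [∀ a, TopologicalSpace (D₂ a)]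
  [FiberBundle F₂ D₂] [VectorBundle ℝ F₂ D₂]
  (𝒟 : DoubleVectorBundle (EM := EM) FA A FE E F₁ D₁ F₂ D₂)
  {m : M} {x x₁ x₂ x₃ : E m} {y : A m}

theorem exists_flip_eq (d : D₁ ⟨m, x⟩) (hd : 𝒟.p ⟨m, x⟩ d = y) :
    ∃ d' : D₂ ⟨m, y⟩, 𝒟.flip ⟨⟨m, x⟩, d⟩ = ⟨⟨m, y⟩, d'⟩ := by
  have h := 𝒟.proj_flip ⟨m, x⟩ d
  rw [hd] at h
  generalize 𝒟.flip ⟨⟨m, x⟩, d⟩ = w at h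
  obtain ⟨a, d'⟩ := w
  subst h
  exact ⟨d', rfl⟩

theorem exists_flip_symm_eq (d' : D₂ ⟨m, y⟩) (hd : 𝒟.pD ⟨m, y⟩ d' = x) :
    ∃ d : D₁ ⟨m, x⟩, 𝒟.flip ⟨⟨m, x⟩, d⟩ = ⟨⟨m, y⟩, d'⟩ := by
  have h := 𝒟.proj_flip_symm ⟨m, y⟩ d'
  rw [hd] at h
  have h' := 𝒟.flip.apply_symm_apply ⟨⟨m, y⟩, d'⟩
  generalize 𝒟.flip.symm ⟨⟨m, y⟩, d'⟩ = w at h h'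
  obtain ⟨e, d⟩ := w
  subst h
  exact ⟨d, h'⟩

theorem p_eq_of_flip_eq {d : D₁ ⟨m, x⟩} {d' : D₂ ⟨m, y⟩}
    (h : 𝒟.flip ⟨⟨m, x⟩, d⟩ = ⟨⟨m, y⟩, d'⟩) : 𝒟.p ⟨m, x⟩ d = y := by
  have := 𝒟.proj_flip ⟨m, x⟩ d
  rw [h] at this
  simpa using this.symm

theorem pD_eq_of_flip_eq {d : D₁ ⟨m, x⟩} {d' : D₂ ⟨m, y⟩}
    (h : 𝒟.flip ⟨⟨m, x⟩, d⟩ = ⟨⟨m, y⟩, d'⟩) : 𝒟.pD ⟨m, y⟩ d' = x := by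
  have := 𝒟.proj_flip_symm ⟨m, y⟩ d'
  rw [← h, 𝒟.flip.symm_apply_apply] at this
  simpa using this.symm

variable {𝒟}

theorem sumA_iff {d₁ : D₁ ⟨m, x₁⟩} {d₂ : D₁ ⟨m, x₂⟩} {d : D₁ ⟨m, x₃⟩} :
    𝒟.SumA ⟨⟨m, x₁⟩, d₁⟩ ⟨⟨m, x₂⟩, d₂⟩ ⟨⟨m, x₃⟩, d⟩ ↔
      ∃ (y : A m) (u v : D₂ ⟨m, y⟩), 𝒟.flip ⟨⟨m, x₁⟩, d₁⟩ = ⟨⟨m, y⟩, u⟩ ∧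
        𝒟.flip ⟨⟨m, x₂⟩, d₂⟩ = ⟨⟨m, y⟩, v⟩ ∧ 𝒟.flip ⟨⟨m, x₃⟩, d⟩ = ⟨⟨m, y⟩, u + v⟩ := by
  refine ⟨fun ⟨a, u, v, hu, hv, hw⟩ => ?_, fun ⟨y, u, v, hu, hv, hw⟩ => ⟨_, u, v, hu, hv, hw⟩⟩
  have h := 𝒟.proj_flip ⟨m, x₁⟩ d₁
  rw [hu] at h
  change a = _ at h
  subst h
  exact ⟨_, u, v, hu, hv, hw⟩

theorem SumA.p_left {d₁ : D₁ ⟨m, x₁⟩} {d₂ : D₁ ⟨m, x₂⟩} {d : D₁ ⟨m, x₃⟩}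
    (h : 𝒟.SumA ⟨⟨m, x₁⟩, d₁⟩ ⟨⟨m, x₂⟩, d₂⟩ ⟨⟨m, x₃⟩, d⟩) : 𝒟.p ⟨m, x₁⟩ d₁ = 𝒟.p ⟨m, x₃⟩ d := by
  obtain ⟨y, u, v, hu, hv, hw⟩ := sumA_iff.1 h
  rw [𝒟.p_eq_of_flip_eq hu, 𝒟.p_eq_of_flip_eq hw]

theorem SumA.p_right {d₁ : D₁ ⟨m, x₁⟩} {d₂ : D₁ ⟨m, x₂⟩} {d : D₁ ⟨m, x₃⟩}
    (h : 𝒟.SumA ⟨⟨m, x₁⟩, d₁⟩ ⟨⟨m, x₂⟩, d₂⟩ ⟨⟨m, x₃⟩, d⟩) : 𝒟.p ⟨m, x₂⟩ d₂ = 𝒟.p ⟨m, x₃⟩ d := by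
  obtain ⟨y, u, v, hu, hv, hw⟩ := sumA_iff.1 h
  rw [𝒟.p_eq_of_flip_eq hv, 𝒟.p_eq_of_flip_eq hw]

variable (𝒟) in
theorem exists_sumA (d₁ : D₁ ⟨m, x₁⟩) (d₂ : D₁ ⟨m, x₂⟩)
    (h : 𝒟.p ⟨m, x₁⟩ d₁ = 𝒟.p ⟨m, x₂⟩ d₂) (hx : x₁ + x₂ = x₃) :
    ∃ d : D₁ ⟨m, x₃⟩, 𝒟.SumA ⟨⟨m, x₁⟩, d₁⟩ ⟨⟨m, x₂⟩, d₂⟩ ⟨⟨m, x₃⟩, d⟩ := by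
  obtain ⟨u, hu⟩ := 𝒟.exists_flip_eq d₁ h
  obtain ⟨v, hv⟩ := 𝒟.exists_flip_eq d₂ rfl
  obtain ⟨d, hd⟩ := 𝒟.exists_flip_symm_eq (x := x₃) (u + v) (by
    rw [map_add, 𝒟.pD_eq_of_flip_eq hu, 𝒟.pD_eq_of_flip_eq hv, hx])
  exact ⟨d, _, u, v, hu, hv, hd⟩

variable (𝒟) in
theorem exists_sumA_left (d₁ : D₁ ⟨m, x₁⟩) (d : D₁ ⟨m, x₃⟩)
    (h : 𝒟.p ⟨m, x₁⟩ d₁ = 𝒟.p ⟨m, x₃⟩ d) (hx : x₁ + x₂ = x₃) :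
    ∃ d₂ : D₁ ⟨m, x₂⟩, 𝒟.SumA ⟨⟨m, x₁⟩, d₁⟩ ⟨⟨m, x₂⟩, d₂⟩ ⟨⟨m, x₃⟩, d⟩ := by
  obtain ⟨u, hu⟩ := 𝒟.exists_flip_eq d₁ h
  obtain ⟨w, hw⟩ := 𝒟.exists_flip_eq d rfl
  obtain ⟨d₂, hd⟩ := 𝒟.exists_flip_symm_eq (x := x₂) (w - u) (by
    rw [map_sub, 𝒟.pD_eq_of_flip_eq hu, 𝒟.pD_eq_of_flip_eq hw]; exact sub_eq_of_eq_add' hx.symm)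
  exact ⟨d₂, _, u, w - u, hu, hd, by rw [hw, add_sub_cancel]⟩

theorem SumA.unique {d₁ d₂ d d' : TotalSpace F₁ D₁} (h : 𝒟.SumA d₁ d₂ d) (h' : 𝒟.SumA d₁ d₂ d') :
    d = d' := by
  obtain ⟨a, u, v, hu, hv, hw⟩ := h
  obtain ⟨a', u', v', hu', hv', hw'⟩ := h'
  obtain ⟨rfl, hu''⟩ := TotalSpace.mk.inj (hu.symm.trans hu')
  obtain ⟨-, hv''⟩ := TotalSpace.mk.inj (hv.symm.trans hv')
  obtain rfl := eq_of_heq hu''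
  obtain rfl := eq_of_heq hv''
  exact 𝒟.flip.injective (hw.trans hw'.symm)

theorem SumA.unique_right {d₁ d₂ d₂' d : TotalSpace F₁ D₁} (h : 𝒟.SumA d₁ d₂ d)
    (h' : 𝒟.SumA d₁ d₂' d) : d₂ = d₂' := by
  obtain ⟨a, u, v, hu, hv, hw⟩ := h
  obtain ⟨a', u', v', hu', hv', hw'⟩ := h'
  obtain ⟨rfl, hu''⟩ := TotalSpace.mk.inj (hu.symm.trans hu')
  obtain ⟨-, hw''⟩ := TotalSpace.mk.inj (hw.symm.trans hw')
  obtain rfl := eq_of_heq hu''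
  obtain rfl := add_left_cancel (eq_of_heq hw'')
  exact 𝒟.flip.injective (hv.trans hv'.symm)

theorem SumA.add {d₁ d₁' : D₁ ⟨m, x₁⟩} {d₂ d₂' : D₁ ⟨m, x₂⟩} {d d' : D₁ ⟨m, x₃⟩}
    (h : 𝒟.SumA ⟨⟨m, x₁⟩, d₁⟩ ⟨⟨m, x₂⟩, d₂⟩ ⟨⟨m, x₃⟩, d⟩)
    (h' : 𝒟.SumA ⟨⟨m, x₁⟩, d₁'⟩ ⟨⟨m, x₂⟩, d₂'⟩ ⟨⟨m, x₃⟩, d'⟩) :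
    𝒟.SumA ⟨⟨m, x₁⟩, d₁ + d₁'⟩ ⟨⟨m, x₂⟩, d₂ + d₂'⟩ ⟨⟨m, x₃⟩, d + d'⟩ :=
  𝒟.interchange _ _ _ _ _ _ _ _ _ h h' ⟨_, d₁, d₁', rfl, rfl, rfl⟩ ⟨_, d₂, d₂', rfl, rfl, rfl⟩
    ⟨_, d, d', rfl, rfl, rfl⟩

-- By interchange the sum `d` of two zeros satisfies `d + d = d`.
variable (𝒟) in
theorem sumA_zero (hx : x₁ + x₂ = x₃) :
    𝒟.SumA ⟨⟨m, x₁⟩, 0⟩ ⟨⟨m, x₂⟩, 0⟩ ⟨⟨m, x₃⟩, 0⟩ := by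
  obtain ⟨d, hd⟩ := 𝒟.exists_sumA (x₁ := x₁) (x₂ := x₂) (x₃ := x₃) 0 0 (by simp) hx
  have h := hd.add hd
  rw [add_zero, add_zero] at h
  have h0 := TotalSpace.mk_inj.1 (h.unique hd)
  rw [add_eq_right] at h0
  rwa [h0] at hd

/-- Curves `t ↦ t d` in a fibre are smooth. -/
theorem contMDiff_mk_smul (e : TotalSpace FE E) (d : D₁ e) :
    ContMDiff 𝓘(ℝ, ℝ) ((𝓘(ℝ, EM).prod 𝓘(ℝ, FE)).prod 𝓘(ℝ, F₁)) ∞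
      (fun t : ℝ => (⟨e, t • d⟩ : TotalSpace F₁ D₁)) := fun t =>
  ContMDiffAt.fibreSMul (contMDiffAt_id (x := t)) (contMDiffAt_const (c := (⟨e, d⟩ : TotalSpace F₁ D₁)))

/-- Interchange for sums gives only additivity in the scalar. But `s ↦ s d₁ +_A s d₂` is also
continuous, and continuous additive maps from `ℝ` are linear. -/
theorem SumA.smul {d₁ : D₁ ⟨m, x₁⟩} {d₂ : D₁ ⟨m, x₂⟩} {d : D₁ ⟨m, x₃⟩}
    (h : 𝒟.SumA ⟨⟨m, x₁⟩, d₁⟩ ⟨⟨m, x₂⟩, d₂⟩ ⟨⟨m, x₃⟩, d⟩) (t : ℝ) :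
    𝒟.SumA ⟨⟨m, x₁⟩, t • d₁⟩ ⟨⟨m, x₂⟩, t • d₂⟩ ⟨⟨m, x₃⟩, t • d⟩ := by
  have hx : x₁ + x₂ = x₃ := by
    obtain ⟨y, u, v, hu, hv, hw⟩ := sumA_iff.1 h
    rw [← 𝒟.pD_eq_of_flip_eq hu, ← 𝒟.pD_eq_of_flip_eq hv, ← 𝒟.pD_eq_of_flip_eq hw, map_add]
  have hp : ∀ s : ℝ, 𝒟.p ⟨m, x₁⟩ (s • d₁) = 𝒟.p ⟨m, x₂⟩ (s • d₂) := fun s => by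
    rw [map_smul, map_smul, h.p_left, h.p_right]
  choose g hg using fun s : ℝ => 𝒟.exists_sumA (s • d₁) (s • d₂) (hp s) hx
  have hadd : ∀ s s', g (s + s') = g s + g s' := fun s s' => by
    have := (hg s).add (hg s')
    rw [← add_smul, ← add_smul] at this
    exact TotalSpace.mk_inj.1 ((hg (s + s')).unique this)
  have hcont : Continuous fun s => (⟨⟨m, x₃⟩, g s⟩ : TotalSpace F₁ D₁) := by
    have h1 : ContMDiff 𝓘(ℝ, ℝ) _ ∞ fun s => 𝒟.flip (⟨⟨m, x₃⟩, g s⟩ : TotalSpace F₁ D₁) := fun s =>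
      ContMDiffAt.fibreSum
        ((𝒟.flip.contMDiff.comp (contMDiff_mk_smul _ d₁)) s)
        ((𝒟.flip.contMDiff.comp (contMDiff_mk_smul _ d₂)) s) (Filter.Eventually.of_forall hg)
    have h2 := 𝒟.flip.symm.contMDiff.continuous.comp h1.continuous
    exact h2.congr fun s => 𝒟.flip.symm_apply_apply _
  have hlin := map_real_smul_of_continuous_totalSpace (AddMonoidHom.mk' g hadd) hcont t
  have h1 : g 1 = d := by
    have := hg 1
    rw [one_smul, one_smul] at this
    exact TotalSpace.mk_inj.1 (this.unique h)
  have := hg t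
  rwa [show g t = t • d by rw [← h1]; exact hlin] at this

variable (𝒟) in
theorem exists_smulA (t : ℝ) (d : D₁ ⟨m, x⟩) :
    ∃ d' : D₁ ⟨m, t • x⟩, 𝒟.smulA t ⟨⟨m, x⟩, d⟩ = ⟨⟨m, t • x⟩, d'⟩ ∧
      𝒟.p ⟨m, t • x⟩ d' = 𝒟.p ⟨m, x⟩ d := by
  obtain ⟨u, hu⟩ := 𝒟.exists_flip_eq d rfl
  obtain ⟨d', hd⟩ := 𝒟.exists_flip_symm_eq (x := t • x) (t • u) (by
    rw [map_smul, 𝒟.pD_eq_of_flip_eq hu])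
  refine ⟨d', ?_, 𝒟.p_eq_of_flip_eq hd⟩
  rw [smulA, hu]
  apply 𝒟.flip.injective
  exact (𝒟.flip.apply_symm_apply _).trans hd.symm

theorem smulA_add {t : ℝ} {d₁ d₂ : D₁ ⟨m, x⟩} {d₁' d₂' : D₁ ⟨m, x₁⟩}
    (h₁ : 𝒟.smulA t ⟨⟨m, x⟩, d₁⟩ = ⟨⟨m, x₁⟩, d₁'⟩)
    (h₂ : 𝒟.smulA t ⟨⟨m, x⟩, d₂⟩ = ⟨⟨m, x₁⟩, d₂'⟩) :
    𝒟.smulA t ⟨⟨m, x⟩, d₁ + d₂⟩ = ⟨⟨m, x₁⟩, d₁' + d₂'⟩ := by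
  have h : FibreSum (𝒟.smulA t ⟨⟨m, x⟩, d₁⟩) (𝒟.smulA t ⟨⟨m, x⟩, d₂⟩) (𝒟.smulA t ⟨⟨m, x⟩, d₁ + d₂⟩) :=
    𝒟.smul_interchange t _ _ _ ⟨_, d₁, d₂, rfl, rfl, rfl⟩
  rw [h₁, h₂] at h
  obtain ⟨e, u, v, hu, hv, hw⟩ := h
  obtain ⟨rfl, hu'⟩ := TotalSpace.mk.inj hu
  obtain rfl := eq_of_heq hu'
  obtain rfl := TotalSpace.mk_inj.1 hv
  exact hw

/-- As for `SumA.smul`, the map `s ↦ t ·_A (s d)` is additive and continuous, so the two scalar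
multiplications commute. -/
theorem smulA_smul {t : ℝ} {d : D₁ ⟨m, x⟩} {d' : D₁ ⟨m, t • x⟩}
    (h : 𝒟.smulA t ⟨⟨m, x⟩, d⟩ = ⟨⟨m, t • x⟩, d'⟩) (s : ℝ) :
    𝒟.smulA t ⟨⟨m, x⟩, s • d⟩ = ⟨⟨m, t • x⟩, s • d'⟩ := by
  choose g hg _ using fun s : ℝ => 𝒟.exists_smulA t (s • d)
  have hadd : ∀ s s', g (s + s') = g s + g s' := fun s s' => by
    have := smulA_add (hg s) (hg s')
    rw [← add_smul, hg] at this
    exact TotalSpace.mk_inj.1 this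
  have hcont : Continuous fun s => (⟨⟨m, t • x⟩, g s⟩ : TotalSpace F₁ D₁) := by
    have h1 : ContMDiff 𝓘(ℝ, ℝ) _ ∞ fun s : ℝ =>
        fibreSMul t (𝒟.flip (⟨⟨m, x⟩, s • d⟩ : TotalSpace F₁ D₁)) := fun s =>
      ContMDiffAt.fibreSMul contMDiffAt_const ((𝒟.flip.contMDiff.comp (contMDiff_mk_smul _ d)) s)
    exact (𝒟.flip.symm.contMDiff.continuous.comp h1.continuous).congr hg
  have hlin := map_real_smul_of_continuous_totalSpace (AddMonoidHom.mk' g hadd) hcont s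
  have h1 : g 1 = d' := by
    have := hg 1
    rw [one_smul, h] at this
    exact (TotalSpace.mk_inj.1 this).symm
  rw [hg, show g s = s • d' by rw [← h1]; exact hlin]

variable (𝒟 m) in
/-- The families `(d_x)_{x ∈ E_m}` of elements of `D` which are linear for the vector bundle
structure over `A`. -/
def linearFamilies : Submodule ℝ ((x : E m) → D₁ ⟨m, x⟩) where
  carrier := {X | (∀ x₁ x₂, 𝒟.SumA ⟨⟨m, x₁⟩, X x₁⟩ ⟨⟨m, x₂⟩, X x₂⟩ ⟨⟨m, x₁ + x₂⟩, X (x₁ + x₂)⟩) ∧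
    ∀ (t : ℝ) x, 𝒟.smulA t ⟨⟨m, x⟩, X x⟩ = ⟨⟨m, t • x⟩, X (t • x)⟩}
  add_mem' h h' := ⟨fun x₁ x₂ => (h.1 x₁ x₂).add (h'.1 x₁ x₂),
    fun t x => smulA_add (h.2 t x) (h'.2 t x)⟩
  -- That `t ·_A 0` is again a zero is the case `s = 0` of `smulA_smul`.
  zero_mem' := ⟨fun _ _ => 𝒟.sumA_zero rfl, fun t x => by
    obtain ⟨d', hd', -⟩ := 𝒟.exists_smulA t (0 : D₁ ⟨m, x⟩)
    have := smulA_smul hd' 0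
    rwa [smul_zero, zero_smul] at this⟩
  smul_mem' s _ h := ⟨fun x₁ x₂ => (h.1 x₁ x₂).smul s, fun t x => smulA_smul (h.2 t x) s⟩

theorem isLinearSection_iff {X : Cₛ^∞⟮𝓘(ℝ, EM).prod 𝓘(ℝ, FE); F₁, D₁⟯}
    {a : Cₛ^∞⟮𝓘(ℝ, EM); FA, A⟯} :
    𝒟.IsLinearSection X a ↔
      (∀ m x, 𝒟.p ⟨m, x⟩ (X ⟨m, x⟩) = a m) ∧ ∀ m, (fun x => X ⟨m, x⟩) ∈ 𝒟.linearFamilies m := by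
  refine ⟨fun h => ⟨fun m x => h.covers ⟨m, x⟩, fun m => ⟨fun x₁ x₂ => ?_, fun t x => ?_⟩⟩,
    fun h => ⟨fun e => h.1 e.1 e.2, fun e₁ e₂ e he => ?_, fun t e => ?_⟩⟩
  · exact h.map_add _ _ _ ⟨m, x₁, x₂, rfl, rfl, rfl⟩
  · exact (h.map_smul t ⟨m, x⟩).symm
  · obtain ⟨m, x₁, x₂, rfl, rfl, rfl⟩ := he
    exact (h.2 m).1 x₁ x₂
  · exact ((h.2 e.1).2 t e.2).symm

end DoubleVectorBundle

/-! ### Linear lifts in double vector bundles -/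

namespace DoubleVectorBundle

variable {EM : Type*} [NormedAddCommGroup EM] [NormedSpace ℝ EM] [FiniteDimensional ℝ EM]
  {M : Type*} [TopologicalSpace M] [ChartedSpace EM M] [IsManifold 𝓘(ℝ, EM) ∞ M]
  {FA : Type*} [NormedAddCommGroup FA] [NormedSpace ℝ FA] [FiniteDimensional ℝ FA]
  {A : M → Type*} [TopologicalSpace (TotalSpace FA A)]
  [∀ m, AddCommGroup (A m)] [∀ m, Module ℝ (A m)] [∀ m, TopologicalSpace (A m)]
  [FiberBundle FA A] [VectorBundle ℝ FA A] [ContMDiffVectorBundle ∞ FA A 𝓘(ℝ, EM)]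
  {FE : Type*} [NormedAddCommGroup FE] [NormedSpace ℝ FE] [FiniteDimensional ℝ FE]
  {E : M → Type*} [TopologicalSpace (TotalSpace FE E)]
  [∀ m, AddCommGroup (E m)] [∀ m, Module ℝ (E m)] [∀ m, TopologicalSpace (E m)]
  [FiberBundle FE E] [VectorBundle ℝ FE E] [ContMDiffVectorBundle ∞ FE E 𝓘(ℝ, EM)]
  {F₁ : Type*} [NormedAddCommGroup F₁] [NormedSpace ℝ F₁] [FiniteDimensional ℝ F₁]
  {D₁ : TotalSpace FE E → Type*} [TopologicalSpace (TotalSpace F₁ D₁)]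
  [∀ e, AddCommGroup (D₁ e)] [∀ e, Module ℝ (D₁ e)] [∀ e, TopologicalSpace (D₁ e)]
  [FiberBundle F₁ D₁] [VectorBundle ℝ F₁ D₁]
  [ContMDiffVectorBundle ∞ F₁ D₁ (𝓘(ℝ, EM).prod 𝓘(ℝ, FE))]
  {F₂ : Type*} [NormedAddCommGroup F₂] [NormedSpace ℝ F₂] [FiniteDimensional ℝ F₂]
  {D₂ : TotalSpace FA A → Type*} [TopologicalSpace (TotalSpace F₂ D₂)]
  [∀ a, AddCommGroup (D₂ a)] [∀ a, Module ℝ (D₂ a)] [∀ a, TopologicalSpace (D₂ a)]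
  [FiberBundle F₂ D₂] [VectorBundle ℝ F₂ D₂]
  [ContMDiffVectorBundle ∞ F₂ D₂ (𝓘(ℝ, EM).prod 𝓘(ℝ, FA))]
  (𝒟 : DoubleVectorBundle (EM := EM) FA A FE E F₁ D₁ F₂ D₂)
  {m : M}

theorem contMDiff_p : ContMDiff ((𝓘(ℝ, EM).prod 𝓘(ℝ, FE)).prod 𝓘(ℝ, F₁))
    (𝓘(ℝ, EM).prod 𝓘(ℝ, FA)) ∞
    (fun d : TotalSpace F₁ D₁ => (⟨d.proj.proj, 𝒟.p d.proj d.snd⟩ : TotalSpace FA A)) :=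
  ((contMDiff_proj D₂).comp 𝒟.flip.contMDiff).congr fun d => (𝒟.proj_flip d.proj d.snd).symm

theorem contMDiff_pD : ContMDiff ((𝓘(ℝ, EM).prod 𝓘(ℝ, FA)).prod 𝓘(ℝ, F₂))
    (𝓘(ℝ, EM).prod 𝓘(ℝ, FE)) ∞
    (fun d : TotalSpace F₂ D₂ => (⟨d.proj.proj, 𝒟.pD d.proj d.snd⟩ : TotalSpace FE E)) :=
  ((contMDiff_proj D₁).comp 𝒟.flip.symm.contMDiff).congr fun d =>
    (𝒟.proj_flip_symm d.proj d.snd).symm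

/-- The map `D → E ×_M A` is onto. -/
theorem exists_p_eq (x : E m) (y : A m) : ∃ d : D₁ ⟨m, x⟩, 𝒟.p ⟨m, x⟩ d = y := by
  let z : TotalSpace FA A := ⟨m, 0⟩
  -- Over the zero of `A_m` surjectivity is clear: the zero of `D → E` at `x` lies over it.
  have hsurj : Function.Surjective (𝒟.pD z) := fun x => by
    obtain ⟨d', hd'⟩ := 𝒟.exists_flip_eq (0 : D₁ ⟨m, x⟩) (map_zero _)
    exact ⟨d', 𝒟.pD_eq_of_flip_eq hd'⟩
  obtain ⟨U, -, hU, hzU, q, S, -, hS⟩ := exists_local_splitting (z := id) 𝒟.contMDiff_pD isOpen_univ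
    (contMDiffOn_id (I := 𝓘(ℝ, EM).prod 𝓘(ℝ, FA))) (Set.mem_univ z) hsurj (trivializationAt F₂ D₂ z)
    (trivializationAt FE E z.proj) (FiberBundle.mem_baseSet_trivializationAt F₂ D₂ z)
    (FiberBundle.mem_baseSet_trivializationAt FE E z.proj)
  have hcont : Continuous fun t : ℝ => (⟨m, t • y⟩ : TotalSpace FA A) := by
    have : ContMDiff 𝓘(ℝ, ℝ) (𝓘(ℝ, EM).prod 𝓘(ℝ, FA)) ∞
        fun t : ℝ => (⟨m, t • y⟩ : TotalSpace FA A) := fun t =>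
      ContMDiffAt.fibreSMul (contMDiffAt_id (x := t))
        (contMDiffAt_const (c := (⟨m, y⟩ : TotalSpace FA A)))
    exact this.continuous
  -- Surjectivity of `pD` is open, so it holds over `t y` for some `t ≠ 0`. Dividing in the fibre of
  -- `D → E` by `t` moves the element to `y` without moving `x`.
  have hev : ∀ᶠ t : ℝ in 𝓝[≠] 0, (⟨m, t • y⟩ : TotalSpace FA A) ∈ U :=
    nhdsWithin_le_nhds (hcont.continuousAt.preimage_mem_nhds (hU.mem_nhds (by
      simpa [z] using hzU)))
  obtain ⟨t, htU, ht0⟩ := (hev.and self_mem_nhdsWithin).exists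
  obtain ⟨h1, h2, -, h3⟩ := hS _ htU
  have h4 := (h3 ((trivializationAt FE E z.proj) ⟨m, x⟩).2 0).1
  have h5 := Trivialization.snd_injective _ h2 h4
  obtain ⟨d, hd⟩ := 𝒟.exists_flip_symm_eq _ h5
  refine ⟨t⁻¹ • d, ?_⟩
  rw [map_smul, 𝒟.p_eq_of_flip_eq hd, smul_smul, inv_mul_cancel₀ ht0, one_smul]

theorem p_surjective (e : TotalSpace FE E) : Function.Surjective (𝒟.p e) :=
  fun y => 𝒟.exists_p_eq e.snd y

theorem pD_surjective (a : TotalSpace FA A) : Function.Surjective (𝒟.pD a) := fun x => by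
  obtain ⟨d, hd⟩ := 𝒟.exists_p_eq x a.snd
  obtain ⟨d', hd'⟩ := 𝒟.exists_flip_eq d hd
  exact ⟨d', 𝒟.pD_eq_of_flip_eq hd'⟩

/-- Every local section of `A` is locally covered by a linear section of `D → E`. -/
theorem exists_local_linear_section {a : (m : M) → A m} {U₀ : Set M} (hU₀ : IsOpen U₀)
    (ha : ContMDiffOn 𝓘(ℝ, EM) (𝓘(ℝ, EM).prod 𝓘(ℝ, FA)) ∞
      (fun m => (⟨m, a m⟩ : TotalSpace FA A)) U₀) {m₀ : M} (hm₀ : m₀ ∈ U₀) :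
    ∃ U ⊆ U₀, IsOpen U ∧ m₀ ∈ U ∧ ∃ X : (e : TotalSpace FE E) → D₁ e,
      (∀ e : TotalSpace FE E, e.proj ∈ U →
        ContMDiffAt (𝓘(ℝ, EM).prod 𝓘(ℝ, FE)) ((𝓘(ℝ, EM).prod 𝓘(ℝ, FE)).prod 𝓘(ℝ, F₁)) ∞
          (fun e => (⟨e, X e⟩ : TotalSpace F₁ D₁)) e) ∧
      ∀ m ∈ U, (∀ x, 𝒟.p ⟨m, x⟩ (X ⟨m, x⟩) = a m) ∧
        (fun x => X ⟨m, x⟩) ∈ 𝒟.linearFamilies m := by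
  classical
  let z : M → TotalSpace FA A := fun m => ⟨m, a m⟩
  let e₂ := trivializationAt F₂ D₂ (z m₀)
  let eE := trivializationAt FE E m₀
  obtain ⟨U, hUU₀, hU, hmU, q, S, hSs, hS⟩ := exists_local_splitting (z := z) 𝒟.contMDiff_pD hU₀
    ha hm₀ (𝒟.pD_surjective _) e₂ eE (FiberBundle.mem_baseSet_trivializationAt F₂ D₂ _)
    (FiberBundle.mem_baseSet_trivializationAt FE E m₀)
  -- A right inverse of `pD` along the section `a`, linear on each `E_m`; read in `D → E` through
  -- `flip`, it is the desired linear section. Values off `U` are irrelevant.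
  let R : (m : M) → E m →ₗ[ℝ] D₂ (z m) := fun m =>
    e₂.symmₗ ℝ (z m) ∘ₗ (S m).toLinearMap ∘ₗ LinearMap.inl ℝ _ _ ∘ₗ eE.linearMapAt ℝ m
  have hR : ∀ m ∈ U, ∀ x, R m x = e₂.symm (z m) (S m ((eE ⟨m, x⟩).2, 0)) := fun m hm x => by
    have h2 : m ∈ eE.baseSet := (hS m hm).2.1
    change e₂.symmₗ ℝ (z m) (S m (eE.linearMapAt ℝ m x, 0)) = _
    rw [e₂.symmₗ_apply (hS m hm).1, eE.linearMapAt_apply, if_pos h2]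
  have hpR : ∀ m ∈ U, ∀ x, 𝒟.pD (z m) (R m x) = x := fun m hm x => by
    rw [hR m hm]
    exact eE.snd_injective (hS m hm).2.1 ((hS m hm).2.2.2 _ 0).1
  have hX : ∀ e : TotalSpace FE E, ∃ d : D₁ e, e.proj ∈ U →
      𝒟.flip ⟨e, d⟩ = ⟨z e.proj, R e.proj e.snd⟩ := fun ⟨m, x⟩ => by
    by_cases hm : m ∈ U
    · obtain ⟨d, hd⟩ := 𝒟.exists_flip_symm_eq _ (hpR m hm x)
      exact ⟨d, fun _ => hd⟩
    · exact ⟨0, fun h => absurd h hm⟩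
  choose X hX using hX
  refine ⟨U, hUU₀, hU, hmU, X, fun e he => ?_, fun m hm => ⟨fun x => ?_, fun x₁ x₂ => ?_, fun t x => ?_⟩⟩
  · have hUE : IsOpen (TotalSpace.proj ⁻¹' U : Set (TotalSpace FE E)) :=
      hU.preimage (FiberBundle.continuous_proj FE E)
    have hprojE : ContMDiffOn (𝓘(ℝ, EM).prod 𝓘(ℝ, FE)) 𝓘(ℝ, EM) ∞ (TotalSpace.proj : TotalSpace FE E → M)
      (TotalSpace.proj ⁻¹' U) := contMDiffOn_proj E
    have h1 : ContMDiffOn (𝓘(ℝ, EM).prod 𝓘(ℝ, FE)) 𝓘(ℝ, FE) ∞ (fun e => (eE e).2)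
        (TotalSpace.proj ⁻¹' U) :=
      contMDiff_snd.comp_contMDiffOn ((eE.contMDiffOn (n := ∞) (IB := 𝓘(ℝ, EM))).mono fun e he =>
        eE.mem_source.2 (hS _ he).2.1)
    have h2 : ContMDiffOn (𝓘(ℝ, EM).prod 𝓘(ℝ, FE)) 𝓘(ℝ, F₂) ∞
        (fun e : TotalSpace FE E => S e.proj ((eE e).2, 0)) (TotalSpace.proj ⁻¹' U) :=
      (hSs.comp hprojE fun _ h => h).clm_apply (h1.prodMk_space contMDiffOn_const)
    have h3 := (e₂.contMDiffOn_symm (n := ∞) (IB := 𝓘(ℝ, EM).prod 𝓘(ℝ, FA))).comp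
      (((ha.mono hUU₀).comp hprojE fun _ h => h).prodMk h2) fun e he => e₂.mem_target.2 (hS _ he).1
    have h4 := 𝒟.flip.symm.contMDiff.comp_contMDiffOn h3
    refine (h4.congr fun e he => ?_).contMDiffAt (hUE.mem_nhds he)
    change _ = 𝒟.flip.symm (e₂.toOpenPartialHomeomorph.symm (z e.proj, S e.proj ((eE e).2, 0)))
    rw [← 𝒟.flip.symm_apply_apply ⟨e, X e⟩, hX e he, hR _ he, e₂.mk_symm (hS _ he).1]
  · exact 𝒟.p_eq_of_flip_eq (hX ⟨m, x⟩ hm)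
  · exact ⟨_, _, _, hX ⟨m, x₁⟩ hm, hX ⟨m, x₂⟩ hm, by rw [hX ⟨m, x₁ + x₂⟩ hm, map_add]⟩
  · rw [smulA, hX ⟨m, x⟩ hm, ← 𝒟.flip.symm_apply_apply ⟨⟨m, t • x⟩, _⟩, hX ⟨m, t • x⟩ hm, map_smul]
    rfl

/-- `θ` is a smooth lift `(e, a) ↦ θ e a` of `E ×_M A` to `D` over `U`, linear in both arguments. -/
structure IsLinearLiftOn (θ : (e : TotalSpace FE E) → A e.proj →ₗ[ℝ] D₁ e) (U : Set M) : Prop where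
  p_apply : ∀ m ∈ U, ∀ (x : E m) (y : A m), 𝒟.p ⟨m, x⟩ (θ ⟨m, x⟩ y) = y
  mem_linearFamilies : ∀ m ∈ U, ∀ y : A m, (fun x => θ ⟨m, x⟩ y) ∈ 𝒟.linearFamilies m
  -- Smoothness is tested pointwise on set-theoretic sections, so that it applies to local frames of
  -- `A` as well as to global sections.
  contMDiffAt : ∀ (a : (m : M) → A m) (e : TotalSpace FE E), e.proj ∈ U →
    ContMDiffAt 𝓘(ℝ, EM) (𝓘(ℝ, EM).prod 𝓘(ℝ, FA)) ∞ (fun m => (⟨m, a m⟩ : TotalSpace FA A)) e.proj →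
    ContMDiffAt (𝓘(ℝ, EM).prod 𝓘(ℝ, FE)) ((𝓘(ℝ, EM).prod 𝓘(ℝ, FE)).prod 𝓘(ℝ, F₁)) ∞
      (fun e => (⟨e, θ e (a e.proj)⟩ : TotalSpace F₁ D₁)) e

theorem exists_isLinearLiftOn_nhds (m₀ : M) :
    ∃ U, IsOpen U ∧ m₀ ∈ U ∧ ∃ θ, 𝒟.IsLinearLiftOn θ U := by
  let eA := trivializationAt FA A m₀
  have hm₀ : m₀ ∈ eA.baseSet := FiberBundle.mem_baseSet_trivializationAt FA A m₀
  let b := Module.finBasis ℝ FA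
  have ha : ∀ i, ContMDiffOn 𝓘(ℝ, EM) (𝓘(ℝ, EM).prod 𝓘(ℝ, FA)) ∞
      (fun m => (⟨m, eA.symm m (b i)⟩ : TotalSpace FA A)) eA.baseSet := fun i => by
    rw [eA.contMDiffOn_section_baseSet_iff]
    exact (contMDiffOn_const (c := b i)).congr fun m hm => by rw [eA.apply_mk_symm hm]
  choose U hUs hU hmU X hXs hX using fun i =>
    𝒟.exists_local_linear_section eA.open_baseSet (ha i) hm₀
  -- `X i` lifts the `i`-th member of a frame of `A`; `θ` is the extension that is linear in the
  -- coordinates of `a`.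
  refine ⟨eA.baseSet ∩ ⋂ i, U i, eA.open_baseSet.inter (isOpen_iInter_of_finite hU),
    ⟨hm₀, Set.mem_iInter.2 hmU⟩,
    fun e => ∑ i, (b.coord i ∘ₗ eA.linearMapAt ℝ e.proj).smulRight (X i e), ?_⟩
  have hUi : ∀ {m}, m ∈ eA.baseSet ∩ ⋂ i, U i → ∀ i, m ∈ U i := fun hm i =>
    Set.mem_iInter.1 hm.2 i
  refine ⟨fun m hm x y => ?_, fun m hm y => ?_, fun a e he hae => ?_⟩
  · simp only [LinearMap.sum_apply, LinearMap.smulRight_apply, map_sum, map_smul]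
    simp only [(hX _ m (hUi hm _)).1 x]
    change ∑ i, b.coord i (eA.linearMapAt ℝ m y) • eA.symm m (b i) = y
    simp only [← eA.symmₗ_apply (R := ℝ) hm.1, ← map_smul, ← map_sum]
    simp only [Module.Basis.coord_apply, b.sum_repr]
    exact eA.symmₗ_linearMapAt hm.1 y
  · have : (fun x => (∑ i, (b.coord i ∘ₗ eA.linearMapAt ℝ m).smulRight (X i ⟨m, x⟩)) y) =
        ∑ i, b.coord i (eA.linearMapAt ℝ m y) • fun x => X i ⟨m, x⟩ := by
      funext x
      simp [LinearMap.sum_apply, Finset.sum_apply]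
    change (fun x => (∑ i, (b.coord i ∘ₗ eA.linearMapAt ℝ m).smulRight (X i ⟨m, x⟩)) y) ∈ _
    rw [this]
    exact Submodule.sum_mem _ fun i _ => Submodule.smul_mem _ _ (hX i m (hUi hm i)).2
  · simp only [LinearMap.sum_apply, LinearMap.smulRight_apply]
    refine ContMDiffAt.sum_section fun i _ => ?_
    refine ContMDiffAt.smul_section ?_ (hXs i e (hUi he i))
    have h1 : ContMDiffAt 𝓘(ℝ, EM) 𝓘(ℝ, FA) ∞ (fun m => (eA ⟨m, a m⟩).2) e.proj :=
      (eA.contMDiffAt_section_iff he.1).1 hae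
    have h2 : ContMDiffAt 𝓘(ℝ, EM) 𝓘(ℝ, ℝ) ∞
        (fun m => b.coord i (eA.linearMapAt ℝ m (a m))) e.proj := by
      have h3 := ((b.coord i).toContinuousLinearMap.contMDiff (n := ∞)).contMDiffAt.comp e.proj h1
      refine h3.congr_of_eventuallyEq ?_
      filter_upwards [eA.open_baseSet.mem_nhds he.1] with m hm
      rw [eA.linearMapAt_apply, if_pos hm]
      rfl
    exact h2.comp e (contMDiffAt_proj E)

variable [T2Space M] [SecondCountableTopology M]

theorem exists_isLinearLiftOn_univ : ∃ θ, 𝒟.IsLinearLiftOn θ Set.univ := by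
  choose U hU hmU θ hθ using 𝒟.exists_isLinearLiftOn_nhds
  have : LocallyCompactSpace M := ChartedSpace.locallyCompactSpace EM M
  obtain ⟨ρ, hρ⟩ := SmoothPartitionOfUnity.exists_isSubordinate 𝓘(ℝ, EM) isClosed_univ U hU
    fun m _ => Set.mem_iUnion.2 ⟨m, hmU m⟩
  have hfin : ∀ (e : TotalSpace FE E), (Function.support fun i => ρ i e.proj • θ i e).Finite := fun e =>
    (ρ.locallyFinite.point_finite e.proj).subset fun i hi h => hi (by
      change ρ i e.proj • θ i e = 0
      rw [h, zero_smul])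
  have happ : ∀ (e : TotalSpace FE E) (y : A e.proj),
      (∑ᶠ i, ρ i e.proj • θ i e) y = ∑ᶠ i, ρ i e.proj • θ i e y := fun e y =>
    (LinearMap.applyₗ y : (A e.proj →ₗ[ℝ] D₁ e) →ₗ[ℝ] D₁ e).toAddMonoidHom.map_finsum (hfin e)
  have hmem : ∀ {i m}, ρ i m ≠ 0 → m ∈ U i := fun {i m} h => hρ i (subset_tsupport _ h)
  refine ⟨fun e => ∑ᶠ i, ρ i e.proj • θ i e, fun m _ x y => ?_, fun m _ y => ?_, fun a e _ hae => ?_⟩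
  · have hf : (Function.support fun i => ρ i m • θ i ⟨m, x⟩ y).Finite :=
      (ρ.locallyFinite.point_finite m).subset fun i hi h => hi (by
        change ρ i m • θ i ⟨m, x⟩ y = 0
        rw [h, zero_smul])
    rw [happ ⟨m, x⟩ y]
    refine ((𝒟.p ⟨m, x⟩).toAddMonoidHom.map_finsum hf).trans ?_
    have : ∀ i, 𝒟.p ⟨m, x⟩ (ρ i m • θ i ⟨m, x⟩ y) = ρ i m • y := fun i => by
      rw [map_smul]
      by_cases h : ρ i m = 0
      · rw [h, zero_smul, zero_smul]
      · rw [(hθ i).p_apply m (hmem h)]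
    refine (finsum_congr this).trans ?_
    refine ((LinearMap.toSpanSingleton ℝ (A m) y).toAddMonoidHom.map_finsum
      (ρ.locallyFinite.point_finite m)).symm.trans ?_
    -- The weights sum to one, so the average of right inverses of `p` is again one.
    rw [ρ.sum_eq_one (Set.mem_univ m)]
    exact one_smul ℝ y
  · let s := (ρ.locallyFinite.point_finite m).toFinset
    have : (fun x => (∑ᶠ i, ρ i m • θ i ⟨m, x⟩) y) =
        ∑ i ∈ s, ρ i m • fun x => θ i ⟨m, x⟩ y := by
      funext x
      rw [happ ⟨m, x⟩ y, Finset.sum_apply]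
      refine finsum_eq_sum_of_support_subset _ fun i hi => ?_
      rw [Set.Finite.coe_toFinset]
      intro h
      apply hi
      change ρ i m • θ i ⟨m, x⟩ y = 0
      rw [h, zero_smul]
    change (fun x => (∑ᶠ i, ρ i m • θ i ⟨m, x⟩) y) ∈ _
    rw [this]
    exact Submodule.sum_mem _ fun i hi => Submodule.smul_mem _ _
      ((hθ i).mem_linearFamilies m (hmem ((Set.Finite.mem_toFinset _).1 hi)) y)
  · simp only [happ]
    refine ContMDiffAt.finsum_section_of_locallyFinite ?_ fun i => ?_
    · refine (ρ.locallyFinite.preimage_continuous (FiberBundle.continuous_proj FE E)).subset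
        fun i e he h => he ?_
      rw [h, zero_smul]
    · by_cases h : e.proj ∈ tsupport (ρ i)
      · exact ((ρ i).contMDiff.contMDiffAt.comp e (contMDiffAt_proj E)).smul_section
          ((hθ i).contMDiffAt a e (hρ i h) hae)
      · refine (contMDiff_zeroSection ℝ D₁).contMDiffAt.congr_of_eventuallyEq ?_
        have : ∀ᶠ e' : TotalSpace FE E in 𝓝 e, e'.proj ∉ tsupport (ρ i) :=
          (FiberBundle.continuous_proj FE E).continuousAt.preimage_mem_nhds
            ((isClosed_tsupport _).isOpen_compl.mem_nhds h)
        filter_upwards [this] with e' he'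
        change (⟨e', ρ i e'.proj • θ i e' (a e'.proj)⟩ : TotalSpace F₁ D₁) = ⟨e', 0⟩
        rw [image_eq_zero_of_notMem_tsupport he', zero_smul]

variable {𝒟} in
/-- The Ehresmann connection spanned by a linear lift. -/
def IsLinearLiftOn.connection {θ : (e : TotalSpace FE E) → A e.proj →ₗ[ℝ] D₁ e}
    (hθ : 𝒟.IsLinearLiftOn θ Set.univ) :
    EhresmannConnection (𝓘(ℝ, EM).prod 𝓘(ℝ, FE)) F₁ (TotalSpace.proj : TotalSpace FE E → M) 𝒟.p where
  H e := LinearMap.range (θ e)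
  isSmoothSubbundle e₀ := by
    let eA := trivializationAt FA A e₀.proj
    let b := Module.finBasis ℝ FA
    have hlf := eA.isLocalFrameOn_localFrame_baseSet 𝓘(ℝ, EM) ∞ b
    refine ⟨TotalSpace.proj ⁻¹' eA.baseSet, eA.open_baseSet.preimage (FiberBundle.continuous_proj FE E),
      FiberBundle.mem_baseSet_trivializationAt FA A e₀.proj, _,
      fun i e => θ e (eA.localFrame b i e.proj), fun i e he => ?_, fun e he => ⟨?_, ?_⟩⟩
    · exact (hθ.contMDiffAt _ e (Set.mem_univ _)
        (contMDiffAt_localFrame_of_mem ∞ eA b i he)).contMDiffWithinAt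
    · refine (hlf.linearIndependent he).map' (θ e) (LinearMap.ker_eq_bot.2 ?_)
      exact Function.LeftInverse.injective (g := 𝒟.p e) fun y => hθ.p_apply e.1 (Set.mem_univ _) e.2 y
    · change _ = LinearMap.range (θ e)
      rw [Set.range_comp' (θ e), ← Submodule.map_span, LinearMap.range_eq_map]
      exact congrArg _ (top_le_iff.1 (hlf.generating he))
  isCompl e := by
    -- The image of a right inverse of `p` is complementary to `ker p`, through `d = (d - θ (p d)) +
    -- θ (p d)`.
    have h : ∀ y, 𝒟.p e (θ e y) = y := fun y => hθ.p_apply e.1 (Set.mem_univ _) e.2 y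
    refine IsCompl.of_le ?_ ?_
    · rintro d ⟨hd, y, rfl⟩
      have := h y
      rw [LinearMap.mem_ker.1 hd] at this
      rw [← this, map_zero]
      exact Submodule.zero_mem _
    · intro d _
      rw [← sub_add_cancel d (θ e (𝒟.p e d))]
      refine Submodule.add_mem_sup ?_ ⟨_, rfl⟩
      rw [LinearMap.mem_ker, map_sub, h, sub_self]

variable {𝒟} in
theorem IsLinearLiftOn.isLinearConnection {θ : (e : TotalSpace FE E) → A e.proj →ₗ[ℝ] D₁ e}
    (hθ : 𝒟.IsLinearLiftOn θ Set.univ) : 𝒟.IsLinearConnection hθ.connection := fun a =>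
  ⟨⟨fun e => θ e (a e.proj), fun e => hθ.contMDiffAt a e (Set.mem_univ _) (a.contMDiff _)⟩,
    ⟨fun _ => ⟨_, rfl⟩, fun e => hθ.p_apply e.1 (Set.mem_univ _) e.2 _⟩,
    isLinearSection_iff.2 ⟨fun m x => hθ.p_apply m (Set.mem_univ _) x _,
      fun m => hθ.mem_linearFamilies m (Set.mem_univ _) (a m)⟩⟩

end DoubleVectorBundle

/-! ### The core of a double vector bundle -/

namespace DoubleVectorBundle

variable {EM : Type*} [NormedAddCommGroup EM] [NormedSpace ℝ EM] [FiniteDimensional ℝ EM]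
  {M : Type*} [TopologicalSpace M] [ChartedSpace EM M] [IsManifold 𝓘(ℝ, EM) ∞ M]
  {FA : Type*} [NormedAddCommGroup FA] [NormedSpace ℝ FA] [FiniteDimensional ℝ FA]
  {A : M → Type*} [TopologicalSpace (TotalSpace FA A)]
  [∀ m, AddCommGroup (A m)] [∀ m, Module ℝ (A m)] [∀ m, TopologicalSpace (A m)]
  [FiberBundle FA A] [VectorBundle ℝ FA A] [ContMDiffVectorBundle ∞ FA A 𝓘(ℝ, EM)]
  {FE : Type*} [NormedAddCommGroup FE] [NormedSpace ℝ FE] [FiniteDimensional ℝ FE]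
  {E : M → Type*} [TopologicalSpace (TotalSpace FE E)]
  [∀ m, AddCommGroup (E m)] [∀ m, Module ℝ (E m)] [∀ m, TopologicalSpace (E m)]
  [FiberBundle FE E] [VectorBundle ℝ FE E] [ContMDiffVectorBundle ∞ FE E 𝓘(ℝ, EM)]
  {F₁ : Type*} [NormedAddCommGroup F₁] [NormedSpace ℝ F₁] [FiniteDimensional ℝ F₁]
  {D₁ : TotalSpace FE E → Type*} [TopologicalSpace (TotalSpace F₁ D₁)]
  [∀ e, AddCommGroup (D₁ e)] [∀ e, Module ℝ (D₁ e)] [∀ e, TopologicalSpace (D₁ e)]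
  [FiberBundle F₁ D₁] [VectorBundle ℝ F₁ D₁]
  [ContMDiffVectorBundle ∞ F₁ D₁ (𝓘(ℝ, EM).prod 𝓘(ℝ, FE))]
  {F₂ : Type*} [NormedAddCommGroup F₂] [NormedSpace ℝ F₂] [FiniteDimensional ℝ F₂]
  {D₂ : TotalSpace FA A → Type*} [TopologicalSpace (TotalSpace F₂ D₂)]
  [∀ a, AddCommGroup (D₂ a)] [∀ a, Module ℝ (D₂ a)] [∀ a, TopologicalSpace (D₂ a)]
  [FiberBundle F₂ D₂] [VectorBundle ℝ F₂ D₂]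
  [ContMDiffVectorBundle ∞ F₂ D₂ (𝓘(ℝ, EM).prod 𝓘(ℝ, FA))]
  {𝒟 : DoubleVectorBundle (EM := EM) FA A FE E F₁ D₁ F₂ D₂}
  {m : M}

variable (𝒟) in
theorem exists_sumA_coreIncl (e : TotalSpace FE E) (c : 𝒟.Core e.proj) :
    ∃ d : D₁ e, 𝒟.SumA ⟨e, 0⟩ (𝒟.coreIncl e.proj c) ⟨e, d⟩ := by
  obtain ⟨m, x⟩ := e
  exact 𝒟.exists_sumA (0 : D₁ ⟨m, x⟩) (c : D₁ ⟨m, 0⟩)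
    (by rw [map_zero]; exact (LinearMap.mem_ker.1 c.2).symm) (add_zero x)

variable (𝒟) in
/-- The linear map `c ↦ 0_e +_A c̄` from the core to the fibre of `D → E` over `e`. -/
def kernelIncl (e : TotalSpace FE E) : 𝒟.Core e.proj →ₗ[ℝ] D₁ e where
  toFun c := (𝒟.exists_sumA_coreIncl e c).choose
  map_add' c c' := by
    have h := (𝒟.exists_sumA_coreIncl e c).choose_spec.add (𝒟.exists_sumA_coreIncl e c').choose_spec
    rw [add_zero] at h
    exact TotalSpace.mk_inj.1 ((𝒟.exists_sumA_coreIncl e (c + c')).choose_spec.unique h)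
  map_smul' t c := by
    have h := (𝒟.exists_sumA_coreIncl e c).choose_spec.smul t
    rw [smul_zero] at h
    exact TotalSpace.mk_inj.1 ((𝒟.exists_sumA_coreIncl e (t • c)).choose_spec.unique h)

theorem sumA_kernelIncl (e : TotalSpace FE E) (c : 𝒟.Core e.proj) :
    𝒟.SumA ⟨e, 0⟩ (𝒟.coreIncl e.proj c) ⟨e, 𝒟.kernelIncl e c⟩ :=
  (𝒟.exists_sumA_coreIncl e c).choose_spec

theorem kernelIncl_injective (e : TotalSpace FE E) : Function.Injective (𝒟.kernelIncl e) := by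
  intro c c' h
  have h1 := sumA_kernelIncl e c
  rw [h] at h1
  exact Subtype.ext (TotalSpace.mk_inj.1 (h1.unique_right (sumA_kernelIncl e c')))

theorem p_kernelIncl (e : TotalSpace FE E) (c : 𝒟.Core e.proj) : 𝒟.p e (𝒟.kernelIncl e c) = 0 := by
  have h : 𝒟.p e 0 = 𝒟.p e (𝒟.kernelIncl e c) := (sumA_kernelIncl e c).p_left
  rw [← h, map_zero]

/-- An element of `ker p` at `e` lies with `0_e` in the fibre of `D → A` over zero. Their difference
there projects to zero in both `E` and `A`, so it is in the core. -/
theorem range_kernelIncl (e : TotalSpace FE E) :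
    LinearMap.range (𝒟.kernelIncl e) = LinearMap.ker (𝒟.p e) := by
  refine le_antisymm ?_ fun d hd => ?_
  · rintro _ ⟨c, rfl⟩
    exact p_kernelIncl e c
  · obtain ⟨m, x⟩ := e
    obtain ⟨c, hc⟩ := 𝒟.exists_sumA_left (x₂ := 0) (0 : D₁ ⟨m, x⟩) d
      (by rw [map_zero, LinearMap.mem_ker.1 hd]) (add_zero x)
    have hcker : 𝒟.p ⟨m, 0⟩ c = 0 := hc.p_right.trans hd
    exact ⟨⟨c, hcker⟩, TotalSpace.mk_inj.1 ((sumA_kernelIncl ⟨m, x⟩ ⟨c, hcker⟩).unique hc)⟩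

theorem p_eq_zero_of_isCoreSection {X : Cₛ^∞⟮𝓘(ℝ, EM).prod 𝓘(ℝ, FE); F₁, D₁⟯}
    (hX : 𝒟.IsCoreSection X) (e : TotalSpace FE E) : 𝒟.p e (X e) = 0 := by
  obtain ⟨c, -, hc⟩ := hX
  have h : 𝒟.p e 0 = 𝒟.p e (X e) := (hc e).p_left
  rw [← h, map_zero]

section Smoothness

variable {EQ : Type*} [NormedAddCommGroup EQ] [NormedSpace ℝ EQ]
  {HQ : Type*} [TopologicalSpace HQ] {IQ : ModelWithCorners ℝ EQ HQ}
  {Q : Type*} [TopologicalSpace Q] [ChartedSpace HQ Q] {e : Q → TotalSpace FE E}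
  {c : (q : Q) → 𝒟.Core (e q).proj} {q₀ : Q}

theorem contMDiffAt_kernelIncl (he : ContMDiffAt IQ (𝓘(ℝ, EM).prod 𝓘(ℝ, FE)) ∞ e q₀)
    (hc : ContMDiffAt IQ ((𝓘(ℝ, EM).prod 𝓘(ℝ, FE)).prod 𝓘(ℝ, F₁)) ∞
      (fun q => 𝒟.coreIncl (e q).proj (c q)) q₀) :
    ContMDiffAt IQ ((𝓘(ℝ, EM).prod 𝓘(ℝ, FE)).prod 𝓘(ℝ, F₁)) ∞
      (fun q => (⟨e q, 𝒟.kernelIncl (e q) (c q)⟩ : TotalSpace F₁ D₁)) q₀ := by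
  have h0 := (contMDiff_zeroSection (n := ∞) (IB := 𝓘(ℝ, EM).prod 𝓘(ℝ, FE)) (F := F₁) ℝ
    D₁).contMDiffAt.comp q₀ he
  have h1 := ContMDiffAt.fibreSum (𝒟.flip.contMDiff.contMDiffAt.comp q₀ h0)
    (𝒟.flip.contMDiff.contMDiffAt.comp q₀ hc)
    (Filter.Eventually.of_forall fun q => sumA_kernelIncl (e q) (c q))
  exact (𝒟.flip.symm.contMDiff.contMDiffAt.comp q₀ h1).congr_of_eventuallyEq
    (Filter.Eventually.of_forall fun q => (𝒟.flip.symm_apply_apply _).symm)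

/-- Converse to `contMDiffAt_kernelIncl`: the core part is recovered by the smooth subtraction of
`0_e` in `D → A`. -/
theorem contMDiffAt_coreIncl (he : ContMDiffAt IQ (𝓘(ℝ, EM).prod 𝓘(ℝ, FE)) ∞ e q₀)
    (hc : ContMDiffAt IQ ((𝓘(ℝ, EM).prod 𝓘(ℝ, FE)).prod 𝓘(ℝ, F₁)) ∞
      (fun q => (⟨e q, 𝒟.kernelIncl (e q) (c q)⟩ : TotalSpace F₁ D₁)) q₀) :
    ContMDiffAt IQ ((𝓘(ℝ, EM).prod 𝓘(ℝ, FE)).prod 𝓘(ℝ, F₁)) ∞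
      (fun q => 𝒟.coreIncl (e q).proj (c q)) q₀ := by
  have h0 := (contMDiff_zeroSection (n := ∞) (IB := 𝓘(ℝ, EM).prod 𝓘(ℝ, FE)) (F := F₁) ℝ
    D₁).contMDiffAt.comp q₀ he
  have h1 := ContMDiffAt.of_fibreSum (𝒟.flip.contMDiff.contMDiffAt.comp q₀ hc)
    (𝒟.flip.contMDiff.contMDiffAt.comp q₀ h0)
    (Filter.Eventually.of_forall fun q => FibreSum.symm (sumA_kernelIncl (e q) (c q)))
  exact (𝒟.flip.symm.contMDiff.contMDiffAt.comp q₀ h1).congr_of_eventuallyEq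
    (Filter.Eventually.of_forall fun q => (𝒟.flip.symm_apply_apply _).symm)

end Smoothness

-- The rank of the core, by rank-nullity for the surjection `p`.
local notation "κ" => (Module.finrank ℝ F₁ - Module.finrank ℝ FA)

variable (𝒟) in
/-- A local trivialization of the core, together with a smooth local extension of its coordinates
to `D`. -/
structure CoreChart where
  U : Set M
  isOpen : IsOpen U
  coord : (m : M) → 𝒟.Core m →ₗ[ℝ] (Fin κ → ℝ)
  frame : (m : M) → (Fin κ → ℝ) →ₗ[ℝ] 𝒟.Core m
  coord_frame : ∀ m ∈ U, ∀ v, coord m (frame m v) = v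
  frame_coord : ∀ m ∈ U, ∀ c, frame m (coord m c) = c
  ext : TotalSpace F₁ D₁ → (Fin κ → ℝ)
  contMDiffAt_ext : ∀ m ∈ U, ∀ c : 𝒟.Core m,
    ContMDiffAt ((𝓘(ℝ, EM).prod 𝓘(ℝ, FE)).prod 𝓘(ℝ, F₁)) 𝓘(ℝ, Fin κ → ℝ) ∞ ext (𝒟.coreIncl m c)
  ext_coreIncl : ∀ m ∈ U, ∀ c : 𝒟.Core m, ext (𝒟.coreIncl m c) = coord m c
  contMDiffOn_frame : ContMDiffOn (𝓘(ℝ, EM).prod 𝓘(ℝ, Fin κ → ℝ))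
    ((𝓘(ℝ, EM).prod 𝓘(ℝ, FE)).prod 𝓘(ℝ, F₁)) ∞
    (fun x : M × (Fin κ → ℝ) => 𝒟.coreIncl x.1 (frame x.1 x.2)) (U ×ˢ Set.univ)

-- The splitting of `p` along the zero section of `E` gives coordinates `(w, c)` in which the core
-- is `w = 0`. So `q` supplies the core coordinates, and it makes sense on all of the trivialization
-- of `D` around the zero section.
variable (𝒟) in
theorem exists_coreChart (m₀ : M) : ∃ φ : 𝒟.CoreChart, m₀ ∈ φ.U := by
  classical
  let z : M → TotalSpace FE E := zeroSection FE E
  have hz : ContMDiff 𝓘(ℝ, EM) (𝓘(ℝ, EM).prod 𝓘(ℝ, FE)) ∞ z := contMDiff_zeroSection ℝ E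
  let e₁ := trivializationAt F₁ D₁ (z m₀)
  let eA := trivializationAt FA A m₀
  obtain ⟨U, -, hU, hmU, q, S, hSs, hS⟩ := exists_local_splitting (z := z) 𝒟.contMDiff_p isOpen_univ
    hz.contMDiffOn (Set.mem_univ m₀) (𝒟.p_surjective _) e₁ eA
    (FiberBundle.mem_baseSet_trivializationAt F₁ D₁ _)
    (FiberBundle.mem_baseSet_trivializationAt FA A m₀)
  have hker : ∀ m ∈ U, ∀ v, e₁.symm (z m) (S m (0, v)) ∈ 𝒟.core m := fun m hm v => by
    have h := ((hS m hm).2.2.2 0 v).1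
    have h0 : (eA ⟨m, 0⟩).2 = 0 := (eA.linear ℝ (hS m hm).2.1).map_zero
    exact eA.snd_injective (hS m hm).2.1 (h.trans h0.symm)
  let coord : (m : M) → 𝒟.Core m →ₗ[ℝ] (Fin κ → ℝ) := fun m =>
    q.toLinearMap ∘ₗ e₁.linearMapAt ℝ (z m) ∘ₗ (𝒟.core m).subtype
  let frame : (m : M) → (Fin κ → ℝ) →ₗ[ℝ] 𝒟.Core m := fun m =>
    if hm : m ∈ U then
      LinearMap.codRestrict (𝒟.core m)
        (e₁.symmₗ ℝ (z m) ∘ₗ (S m).toLinearMap ∘ₗ LinearMap.inr ℝ _ _) fun v => by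
          have := hker m hm v
          rw [← e₁.symmₗ_apply (R := ℝ) (hS m hm).1] at this
          exact this
    else 0
  have hcoord : ∀ m ∈ U, ∀ c : 𝒟.Core m, coord m c = q (e₁ ⟨z m, (c : D₁ ⟨m, 0⟩)⟩).2 :=
    fun m hm c => by
      change q (e₁.linearMapAt ℝ (z m) _) = _
      rw [e₁.linearMapAt_apply, if_pos (hS m hm).1]
      rfl
  have hframe : ∀ m ∈ U, ∀ v, (frame m v : D₁ ⟨m, 0⟩) = e₁.symm (z m) (S m (0, v)) := fun m hm v => by
    simp only [frame, dif_pos hm]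
    exact e₁.symmₗ_apply (hS m hm).1 _
  refine ⟨⟨U, hU, coord, frame, fun m hm v => ?_, fun m hm c => ?_, fun d => q (e₁ d).2,
    fun m hm c => ?_, fun m hm c => (hcoord m hm c).symm, ?_⟩, hmU⟩
  · rw [hcoord m hm, hframe m hm, e₁.apply_mk_symm (hS m hm).1]
    exact ((hS m hm).2.2.2 0 v).2
  · apply Subtype.ext
    rw [hframe m hm, hcoord m hm]
    have h := (hS m hm).2.2.1 (c : D₁ ⟨m, 0⟩)
    have h0 : (eA ⟨m, 𝒟.p ⟨m, 0⟩ c⟩).2 = 0 := by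
      rw [LinearMap.mem_ker.1 c.2]
      exact (eA.linear ℝ (hS m hm).2.1).map_zero
    have h0' : (eA ⟨(z m).proj, 𝒟.p (z m) (c : D₁ ⟨m, 0⟩)⟩).2 = 0 := h0
    rw [h0'] at h
    rw [h]
    exact e₁.symm_apply_apply_mk (hS m hm).1 _
  · have h1 := (e₁.contMDiffOn (n := ∞) (IB := 𝓘(ℝ, EM).prod 𝓘(ℝ, FE))).contMDiffAt
      (x := 𝒟.coreIncl m c) (e₁.open_source.mem_nhds (e₁.mem_source.2 (hS m hm).1))
    exact (q.contMDiff (n := ∞)).contMDiffAt.comp _ (contMDiffAt_snd.comp _ h1)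
  · have h1 : ContMDiffOn (𝓘(ℝ, EM).prod 𝓘(ℝ, Fin κ → ℝ)) 𝓘(ℝ, F₁) ∞
        (fun x : M × (Fin κ → ℝ) => S x.1 (0, x.2)) (U ×ˢ Set.univ) :=
      (hSs.comp contMDiffOn_fst fun x hx => hx.1).clm_apply
        (contMDiffOn_const.prodMk_space contMDiffOn_snd)
    have h2 := (e₁.contMDiffOn_symm (n := ∞) (IB := 𝓘(ℝ, EM).prod 𝓘(ℝ, FE))).comp
      ((hz.comp_contMDiffOn contMDiffOn_fst).prodMk h1) fun x hx => e₁.mem_target.2 (hS _ hx.1).1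
    refine h2.congr fun x hx => ?_
    rw [coreIncl, hframe _ hx.1]
    exact e₁.mk_symm (hS _ hx.1).1 _

/-! ### Coordinate changes of the core, and its vector bundle structure -/

namespace CoreChart

variable (φ : 𝒟.CoreChart)

theorem continuous_coord {m : M} (hm : m ∈ φ.U) : Continuous (φ.coord m) := by
  refine continuous_iff_continuousAt.2 fun c => ?_
  have h1 : ContinuousAt (fun c : 𝒟.Core m => φ.ext (𝒟.coreIncl m c)) c :=
    ContinuousAt.comp (f := fun c : 𝒟.Core m => 𝒟.coreIncl m c)
      (φ.contMDiffAt_ext m hm c).continuousAt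
      ((FiberBundle.continuous_totalSpaceMk F₁ D₁ (⟨m, 0⟩ : TotalSpace FE E)).comp
        continuous_subtype_val).continuousAt
  exact h1.congr (Filter.Eventually.of_forall fun c => φ.ext_coreIncl m hm c)

theorem continuous_frame {m : M} (hm : m ∈ φ.U) : Continuous (φ.frame m) := by
  rw [continuous_induced_rng, (FiberBundle.totalSpaceMk_isInducing F₁ D₁
    (⟨m, 0⟩ : TotalSpace FE E)).continuous_iff]
  exact φ.contMDiffOn_frame.continuousOn.comp_continuous (f := fun v => (m, v))
    (Continuous.prodMk_right m) fun v => ⟨hm, Set.mem_univ _⟩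

/-- The coordinate change between two local trivializations of the core. -/
def coordChange (ψ : 𝒟.CoreChart) (m : M) : (Fin κ → ℝ) →L[ℝ] (Fin κ → ℝ) :=
  (ψ.coord m ∘ₗ φ.frame m).toContinuousLinearMap

theorem contMDiffOn_frame_const (v : Fin κ → ℝ) :
    ContMDiffOn 𝓘(ℝ, EM) ((𝓘(ℝ, EM).prod 𝓘(ℝ, FE)).prod 𝓘(ℝ, F₁)) ∞
      (fun m => 𝒟.coreIncl m (φ.frame m v)) φ.U :=
  φ.contMDiffOn_frame.comp (contMDiffOn_id.prodMk contMDiffOn_const) fun _ hm => ⟨hm, Set.mem_univ v⟩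

/-- The core has no smooth structure yet, so the coordinate change is factored through `D`: a frame
of `φ` is smooth into `D`, and `ψ.ext` is smooth on `D` near the core. -/
theorem contMDiffOn_coordChange (ψ : 𝒟.CoreChart) :
    ContMDiffOn 𝓘(ℝ, EM) 𝓘(ℝ, (Fin κ → ℝ) →L[ℝ] (Fin κ → ℝ)) ∞ (φ.coordChange ψ) (φ.U ∩ ψ.U) := by
  refine ContMDiffOn.clm_of_apply fun v m hm => ?_
  have h1 := (ψ.contMDiffAt_ext m hm.2 (φ.frame m v)).comp_contMDiffWithinAt m
    ((φ.contMDiffOn_frame_const v m hm.1).mono (Set.inter_subset_left (t := ψ.U)))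
  exact h1.congr (fun m' hm' => (ψ.ext_coreIncl m' hm'.2 _).symm) (ψ.ext_coreIncl m hm.2 _).symm

/-- The local trivialization of the core defined by a chart. -/
def pretrivialization : Pretrivialization (Fin κ → ℝ)
    (TotalSpace.proj : TotalSpace (Fin κ → ℝ) 𝒟.Core → M) where
  toFun c := (c.proj, φ.coord c.proj c.snd)
  invFun x := ⟨x.1, φ.frame x.1 x.2⟩
  source := TotalSpace.proj ⁻¹' φ.U
  target := φ.U ×ˢ Set.univ
  map_source' c hc := ⟨hc, Set.mem_univ _⟩
  map_target' x hx := hx.1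
  left_inv' c hc := by
    change (⟨c.proj, φ.frame c.proj (φ.coord c.proj c.snd)⟩ : TotalSpace _ _) = c
    rw [φ.frame_coord _ hc]
  right_inv' x hx := by
    change (x.1, φ.coord x.1 (φ.frame x.1 x.2)) = x
    rw [φ.coord_frame _ hx.1]
  open_target := φ.isOpen.prod isOpen_univ
  baseSet := φ.U
  open_baseSet := φ.isOpen
  source_eq := rfl
  target_eq := rfl
  proj_toFun _ _ := rfl

theorem pretrivialization_symm {m : M} (hm : m ∈ φ.U) (v : Fin κ → ℝ) :
    φ.pretrivialization.symm m v = φ.frame m v := by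
  have h := φ.pretrivialization.mk_symm (b := m) hm v
  exact TotalSpace.mk_inj.1 h

end CoreChart

variable (𝒟) in
/-- The vector bundle structure of the core. -/
def corePrebundle : VectorPrebundle ℝ (Fin κ → ℝ) 𝒟.Core where
  pretrivializationAtlas := Set.range CoreChart.pretrivialization
  pretrivialization_linear' := by
    rintro _ ⟨φ, rfl⟩
    exact ⟨fun m _ => ⟨(φ.coord m).map_add, (φ.coord m).map_smul⟩⟩
  pretrivializationAt m := (𝒟.exists_coreChart m).choose.pretrivialization
  mem_base_pretrivializationAt m := (𝒟.exists_coreChart m).choose_spec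
  pretrivialization_mem_atlas m := ⟨_, rfl⟩
  exists_coordChange := by
    rintro _ ⟨φ, rfl⟩ _ ⟨ψ, rfl⟩
    refine ⟨φ.coordChange ψ, (φ.contMDiffOn_coordChange ψ).continuousOn, fun m hm v => ?_⟩
    rw [φ.pretrivialization_symm hm.1]
    rfl
  totalSpaceMk_isInducing m := by
    let φ := (𝒟.exists_coreChart m).choose
    have hm : m ∈ φ.U := (𝒟.exists_coreChart m).choose_spec
    -- The fibre carries the topology induced from `D₁`; the coordinates are inducing because the
    -- frame is a continuous left inverse.
    refine Topology.IsInducing.of_comp (g := fun x : M × (Fin κ → ℝ) => φ.frame m x.2) ?_ ?_ ?_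
    · exact continuous_const.prodMk (φ.continuous_coord hm)
    · exact (φ.continuous_frame hm).comp continuous_snd
    · have : (fun x : M × (Fin κ → ℝ) => φ.frame m x.2) ∘
          (φ.pretrivialization ∘ TotalSpace.mk m) = id := by
        funext c
        exact φ.frame_coord m hm c
      rw [this]
      exact Topology.IsInducing.id

instance : (corePrebundle 𝒟).IsContMDiff 𝓘(ℝ, EM) ∞ where
  exists_contMDiffCoordChange := by
    rintro _ ⟨φ, rfl⟩ _ ⟨ψ, rfl⟩
    refine ⟨φ.coordChange ψ, φ.contMDiffOn_coordChange ψ, fun m hm v => ?_⟩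
    rw [φ.pretrivialization_symm hm.1]
    rfl

variable (𝒟) in
theorem nonempty_coreBundle : Nonempty (𝒟.CoreBundle κ) := by
  let := (corePrebundle 𝒟).totalSpaceTopology
  let := (corePrebundle 𝒟).toFiberBundle
  have := (corePrebundle 𝒟).toVectorBundle
  have : ContMDiffVectorBundle ∞ (Fin κ → ℝ) 𝒟.Core 𝓘(ℝ, EM) :=
    (corePrebundle 𝒟).contMDiffVectorBundle 𝓘(ℝ, EM)
  refine ⟨⟨inferInstance, inferInstance, inferInstance, inferInstance, fun c => ?_⟩⟩
  obtain ⟨φ, hφ⟩ := 𝒟.exists_coreChart c.proj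
  let e := (corePrebundle 𝒟).trivializationOfMemPretrivializationAtlas ⟨φ, rfl⟩
  have : MemTrivializationAtlas e := ⟨⟨_, ⟨φ, rfl⟩, rfl⟩⟩
  have h1 : ContMDiffOn (𝓘(ℝ, EM).prod 𝓘(ℝ, Fin κ → ℝ)) (𝓘(ℝ, EM).prod 𝓘(ℝ, Fin κ → ℝ)) ∞ e e.source :=
    e.contMDiffOn
  have h2 := φ.contMDiffOn_frame.comp h1 fun c hc => ⟨hc, Set.mem_univ _⟩
  refine (h2.congr fun c hc => ?_).contMDiffAt (e.open_source.mem_nhds hφ)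
  change _ = 𝒟.coreIncl c.proj (φ.frame c.proj (φ.coord c.proj c.snd))
  rw [φ.frame_coord _ hc]

-- Only smoothness involves the bundle structure chosen on the core, and it needs no more than
-- smoothness of the inclusion into `D`.
variable (𝒟) in
theorem exists_isKernelIso (k : ℕ) [𝒟.CoreBundle k] : ∃ i, 𝒟.IsKernelIso k i := by
  refine ⟨fun e => 𝒟.kernelIncl e, sumA_kernelIncl, fun x => ?_, kernelIncl_injective,
    range_kernelIncl⟩
  have h1 := (CoreBundle.contMDiff_coreIncl (𝒟 := 𝒟) (k := k)).comp
    (contMDiff_pullback_lift (V := 𝒟.Core) (F := Fin k → ℝ) (projE EM FE E))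
  exact contMDiffAt_kernelIncl (contMDiffAt_proj _) h1.contMDiffAt

-- The images under `kernelIncl` of a local frame of the core, pulled back to `E`, form a local
-- frame of the kernel.
variable (𝒟) in
theorem isSmoothSubbundle_ker :
    IsSmoothSubbundle (𝓘(ℝ, EM).prod 𝓘(ℝ, FE)) F₁ fun e => LinearMap.ker (𝒟.p e) := by
  intro e₀
  obtain ⟨φ, hφ⟩ := 𝒟.exists_coreChart e₀.proj
  have hU : IsOpen (TotalSpace.proj ⁻¹' φ.U : Set (TotalSpace FE E)) :=
    φ.isOpen.preimage (FiberBundle.continuous_proj FE E)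
  refine ⟨TotalSpace.proj ⁻¹' φ.U, hU, hφ, κ,
    fun i e => 𝒟.kernelIncl e (φ.frame e.proj (Pi.basisFun ℝ _ i)), fun i e he => ?_, fun e he => ⟨?_, ?_⟩⟩
  · have h1 := ((φ.contMDiffOn_frame_const (Pi.basisFun ℝ _ i)).contMDiffAt
      (φ.isOpen.mem_nhds he)).comp e (contMDiffAt_proj E)
    exact (contMDiffAt_kernelIncl contMDiffAt_id h1).contMDiffWithinAt
  · have hinj : Function.Injective (𝒟.kernelIncl e ∘ₗ φ.frame e.proj) :=
      (kernelIncl_injective e).comp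
        (Function.LeftInverse.injective (g := φ.coord e.proj) (φ.coord_frame _ he))
    exact (Pi.basisFun ℝ (Fin κ)).linearIndependent.map' _ (LinearMap.ker_eq_bot.2 hinj)
  · have hr : LinearMap.range (φ.frame e.proj) = ⊤ :=
      LinearMap.range_eq_top.2 (Function.RightInverse.surjective (φ.frame_coord _ he))
    change _ = LinearMap.ker (𝒟.p e)
    rw [← range_kernelIncl, LinearMap.range_eq_map (𝒟.kernelIncl e), ← hr,
      LinearMap.range_eq_map (φ.frame e.proj), ← (Pi.basisFun ℝ (Fin κ)).span_eq,
      Submodule.map_span, Submodule.map_span, ← Set.range_comp, ← Set.range_comp]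
    rfl

/-! ### Core sections as local generators of the sections of the kernel -/

variable (𝒟) in
/-- The core section defined by a section of the core. -/
def coreSection (c : (m : M) → 𝒟.Core m)
    (hc : ContMDiff 𝓘(ℝ, EM) ((𝓘(ℝ, EM).prod 𝓘(ℝ, FE)).prod 𝓘(ℝ, F₁)) ∞
      fun m => 𝒟.coreIncl m (c m)) : Cₛ^∞⟮𝓘(ℝ, EM).prod 𝓘(ℝ, FE); F₁, D₁⟯ :=
  ⟨fun e => 𝒟.kernelIncl e (c e.proj), fun e =>
    contMDiffAt_kernelIncl contMDiffAt_id (hc.contMDiffAt.comp e (contMDiffAt_proj E))⟩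

theorem isCoreSection_coreSection (c : (m : M) → 𝒟.Core m)
    (hc : ContMDiff 𝓘(ℝ, EM) ((𝓘(ℝ, EM).prod 𝓘(ℝ, FE)).prod 𝓘(ℝ, F₁)) ∞
      fun m => 𝒟.coreIncl m (c m)) : 𝒟.IsCoreSection (𝒟.coreSection c hc) :=
  ⟨c, hc, fun e => sumA_kernelIncl e (c e.proj)⟩

/-- Near any point, a section of `ker p` is a combination of core sections. -/
theorem exists_smul_eq_sum_coreSection [T2Space M] {Y : Cₛ^∞⟮𝓘(ℝ, EM).prod 𝓘(ℝ, FE); F₁, D₁⟯}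
    (hY : ∀ e, 𝒟.p e (Y e) = 0) (e₀ : TotalSpace FE E) :
    ∃ u : C^∞⟮𝓘(ℝ, EM).prod 𝓘(ℝ, FE), TotalSpace FE E; ℝ⟯, u e₀ = 1 ∧
      ∃ (g : Fin κ → C^∞⟮𝓘(ℝ, EM).prod 𝓘(ℝ, FE), TotalSpace FE E; ℝ⟯)
        (K : Fin κ → Cₛ^∞⟮𝓘(ℝ, EM).prod 𝓘(ℝ, FE); F₁, D₁⟯),
        (∀ l, 𝒟.IsCoreSection (K l)) ∧ ∀ e, u e • Y e = ∑ l, g l e • K l e := by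
  obtain ⟨φ, hφ⟩ := 𝒟.exists_coreChart e₀.proj
  obtain ⟨χ, -, hχ⟩ := (SmoothBumpFunction.nhds_basis_tsupport (I := 𝓘(ℝ, EM)) e₀.proj).mem_iff.1
    (φ.isOpen.mem_nhds hφ)
  have hχs : ContMDiff (𝓘(ℝ, EM).prod 𝓘(ℝ, FE)) 𝓘(ℝ, ℝ) ∞
      (fun e : TotalSpace FE E => χ e.proj) := χ.contMDiff.comp (contMDiff_proj E)
  have hK : ∀ l, ContMDiff 𝓘(ℝ, EM) ((𝓘(ℝ, EM).prod 𝓘(ℝ, FE)).prod 𝓘(ℝ, F₁)) ∞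
      fun m => 𝒟.coreIncl m (χ m • φ.frame m (Pi.basisFun ℝ _ l)) := fun l m => by
    by_cases hm : m ∈ tsupport χ
    · exact χ.contMDiffAt.fibreSMul
        ((φ.contMDiffOn_frame_const (Pi.basisFun ℝ _ l)).contMDiffAt (φ.isOpen.mem_nhds (hχ hm)))
    · have h0 := ((contMDiff_zeroSection (n := ∞) (IB := 𝓘(ℝ, EM).prod 𝓘(ℝ, FE)) (F := F₁) ℝ
        D₁).comp (contMDiff_zeroSection (n := ∞) (IB := 𝓘(ℝ, EM)) (F := FE) ℝ E)).contMDiffAt (x := m)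
      refine h0.congr_of_eventuallyEq ?_
      filter_upwards [notMem_tsupport_iff_eventuallyEq.1 hm] with m hm
      rw [hm, Pi.zero_apply, zero_smul]
      rfl
  have hc : ∀ e, ∃ c : 𝒟.Core e.proj, 𝒟.kernelIncl e c = Y e := fun e => by
    have : Y e ∈ LinearMap.range (𝒟.kernelIncl e) := by
      rw [range_kernelIncl]
      exact hY e
    exact this
  choose c hc using hc
  have hcs : ∀ e : TotalSpace FE E, e.proj ∈ φ.U → ContMDiffAt (𝓘(ℝ, EM).prod 𝓘(ℝ, FE))
      𝓘(ℝ, Fin κ → ℝ) ∞ (fun e => φ.coord e.proj (c e)) e := fun e he => by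
    have h1 := contMDiffAt_coreIncl (𝒟 := 𝒟) (e := id) (c := c) (contMDiffAt_id (x := e))
      ((Y.contMDiff e).congr_of_eventuallyEq (Filter.Eventually.of_forall fun e =>
        congrArg (TotalSpace.mk e) (hc e)))
    refine ((φ.contMDiffAt_ext _ he (c e)).comp e h1).congr_of_eventuallyEq ?_
    filter_upwards [(φ.isOpen.preimage (FiberBundle.continuous_proj FE E)).mem_nhds he] with e he
    exact (φ.ext_coreIncl _ he (c e)).symm
  have hg : ∀ l, ContMDiff (𝓘(ℝ, EM).prod 𝓘(ℝ, FE)) 𝓘(ℝ, ℝ) ∞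
      (fun e : TotalSpace FE E => χ e.proj * φ.coord e.proj (c e) l) := fun l e => by
    by_cases hm : e.proj ∈ tsupport χ
    · exact hχs.contMDiffAt.mul (contMDiffAt_pi_space.1 (hcs e (hχ hm)) l)
    · refine (contMDiffAt_const (c := (0 : ℝ))).congr_of_eventuallyEq ?_
      filter_upwards [(FiberBundle.continuous_proj FE E).continuousAt.eventually
        (notMem_tsupport_iff_eventuallyEq.1 hm)] with e he
      rw [he, Pi.zero_apply, zero_mul]
  -- The bump function enters twice: one factor extends the coefficients to `E`, the other extends
  -- the core frame to `M`. Hence the square.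
  refine ⟨⟨fun e => χ e.proj * χ e.proj, hχs.mul hχs⟩, ?_, fun l => ⟨_, hg l⟩,
    fun l => 𝒟.coreSection _ (hK l), fun l => isCoreSection_coreSection _ _, fun e => ?_⟩
  · change χ e₀.proj * χ e₀.proj = 1
    rw [χ.eq_one, one_mul]
  · change (χ e.proj * χ e.proj) • Y e = ∑ l, (χ e.proj * φ.coord e.proj (c e) l) •
      𝒟.kernelIncl e (χ e.proj • φ.frame e.proj (Pi.basisFun ℝ _ l))
    by_cases hm : e.proj ∈ tsupport χ
    · rw [← hc e]
      nth_rw 1 [← φ.frame_coord _ (hχ hm) (c e), ← (Pi.basisFun ℝ (Fin κ)).sum_repr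
        (φ.coord e.proj (c e))]
      simp only [map_sum, map_smul, Finset.smul_sum, smul_smul, Pi.basisFun_repr]
      exact Finset.sum_congr rfl fun l _ => by ring_nf
    · rw [image_eq_zero_of_notMem_tsupport hm]
      simp

variable {LD : LieAlgebroid (𝓘(ℝ, EM).prod 𝓘(ℝ, FE)) F₁ D₁} {LA : LieAlgebroid 𝓘(ℝ, EM) FA A}

/-- Core sections locally generate the sections of `ker p`, so by Leibniz it is enough to test `[S,
·]` on them. -/
theorem p_bracket_eq_zero_of_core [T2Space M] {S Y : Cₛ^∞⟮𝓘(ℝ, EM).prod 𝓘(ℝ, FE); F₁, D₁⟯}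
    (hS : ∀ K, 𝒟.IsCoreSection K → ∀ e, 𝒟.p e (LD.bracket S K e) = 0)
    (hY : ∀ e, 𝒟.p e (Y e) = 0) (e : TotalSpace FE E) : 𝒟.p e (LD.bracket S Y e) = 0 := by
  obtain ⟨u, hu, g, K, hK, h⟩ := exists_smul_eq_sum_coreSection hY e
  exact LD.map_bracket_eq_zero_of_sum hu h (hY e) (fun l => p_eq_zero_of_isCoreSection (hK l) e)
    fun l => hS _ (hK l) e

end DoubleVectorBundle

/-! ### VB-algebroids -/

open DoubleVectorBundle

namespace IsVBAlgebroid

variable {EM : Type*} [NormedAddCommGroup EM] [NormedSpace ℝ EM] [FiniteDimensional ℝ EM]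
  {M : Type*} [TopologicalSpace M] [ChartedSpace EM M] [IsManifold 𝓘(ℝ, EM) ∞ M]
  {FA : Type*} [NormedAddCommGroup FA] [NormedSpace ℝ FA] [FiniteDimensional ℝ FA]
  {A : M → Type*} [TopologicalSpace (TotalSpace FA A)]
  [∀ m, AddCommGroup (A m)] [∀ m, Module ℝ (A m)] [∀ m, TopologicalSpace (A m)]
  [FiberBundle FA A] [VectorBundle ℝ FA A] [ContMDiffVectorBundle ∞ FA A 𝓘(ℝ, EM)]
  {FE : Type*} [NormedAddCommGroup FE] [NormedSpace ℝ FE] [FiniteDimensional ℝ FE]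
  {E : M → Type*} [TopologicalSpace (TotalSpace FE E)]
  [∀ m, AddCommGroup (E m)] [∀ m, Module ℝ (E m)] [∀ m, TopologicalSpace (E m)]
  [FiberBundle FE E] [VectorBundle ℝ FE E] [ContMDiffVectorBundle ∞ FE E 𝓘(ℝ, EM)]
  {F₁ : Type*} [NormedAddCommGroup F₁] [NormedSpace ℝ F₁] [FiniteDimensional ℝ F₁]
  {D₁ : TotalSpace FE E → Type*} [TopologicalSpace (TotalSpace F₁ D₁)]
  [∀ e, AddCommGroup (D₁ e)] [∀ e, Module ℝ (D₁ e)] [∀ e, TopologicalSpace (D₁ e)]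
  [FiberBundle F₁ D₁] [VectorBundle ℝ F₁ D₁]
  [ContMDiffVectorBundle ∞ F₁ D₁ (𝓘(ℝ, EM).prod 𝓘(ℝ, FE))]
  {F₂ : Type*} [NormedAddCommGroup F₂] [NormedSpace ℝ F₂] [FiniteDimensional ℝ F₂]
  {D₂ : TotalSpace FA A → Type*} [TopologicalSpace (TotalSpace F₂ D₂)]
  [∀ a, AddCommGroup (D₂ a)] [∀ a, Module ℝ (D₂ a)] [∀ a, TopologicalSpace (D₂ a)]
  [FiberBundle F₂ D₂] [VectorBundle ℝ F₂ D₂]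
  [ContMDiffVectorBundle ∞ F₂ D₂ (𝓘(ℝ, EM).prod 𝓘(ℝ, FA))]
  {𝒟 : DoubleVectorBundle (EM := EM) FA A FE E F₁ D₁ F₂ D₂}
  {LD : LieAlgebroid (𝓘(ℝ, EM).prod 𝓘(ℝ, FE)) F₁ D₁} {LA : LieAlgebroid 𝓘(ℝ, EM) FA A}
  [T2Space M]

theorem p_bracket_linear_ker (h : IsVBAlgebroid 𝒟 LD LA)
    {X Y : Cₛ^∞⟮𝓘(ℝ, EM).prod 𝓘(ℝ, FE); F₁, D₁⟯} {a : Cₛ^∞⟮𝓘(ℝ, EM); FA, A⟯}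
    (hX : 𝒟.IsLinearSection X a) (hY : ∀ e, 𝒟.p e (Y e) = 0) (e : TotalSpace FE E) :
    𝒟.p e (LD.bracket X Y e) = 0 :=
  p_bracket_eq_zero_of_core (fun K hK => p_eq_zero_of_isCoreSection
    (h.bracket_linear_core X K a hX hK)) hY e

theorem p_bracket_ker_ker (h : IsVBAlgebroid 𝒟 LD LA)
    {X Y : Cₛ^∞⟮𝓘(ℝ, EM).prod 𝓘(ℝ, FE); F₁, D₁⟯}
    (hX : ∀ e, 𝒟.p e (X e) = 0) (hY : ∀ e, 𝒟.p e (Y e) = 0) (e : TotalSpace FE E) :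
    𝒟.p e (LD.bracket X Y e) = 0 := by
  -- First `Y` is reduced to a core section, then, by antisymmetry, `X` as well; core sections
  -- commute.
  refine p_bracket_eq_zero_of_core (fun K hK e => ?_) hY e
  rw [LD.bracket_swap, ContMDiffSection.coe_neg, Pi.neg_apply, map_neg, p_bracket_eq_zero_of_core
    (fun K' hK' e => ?_) hX e, neg_zero]
  rw [h.bracket_core_core K K' hK hK', ContMDiffSection.coe_zero, Pi.zero_apply, map_zero]

/-- Homogeneity of `X` and of `ρ_D` makes the anchor field of `X` invariant under fibrewise scaling,
and it projects to `ρ_A(a)`; so `IsCompleteVectorField.of_homogeneous` applies. -/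
theorem isCompleteVectorField_of_isLinearSection (h : IsVBAlgebroid 𝒟 LD LA)
    {X : Cₛ^∞⟮𝓘(ℝ, EM).prod 𝓘(ℝ, FE); F₁, D₁⟯} {a : Cₛ^∞⟮𝓘(ℝ, EM); FA, A⟯}
    (hX : 𝒟.IsLinearSection X a) (ha : IsCompleteVectorField 𝓘(ℝ, EM) (LA.anchorField a)) :
    IsCompleteVectorField (𝓘(ℝ, EM).prod 𝓘(ℝ, FE)) (LD.anchorField X) := by
  refine ha.of_homogeneous ((LD.contMDiff_anchor.comp X.contMDiff).of_le (mod_cast le_top))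
    (fun t e => ?_) ((LA.contMDiff_anchor.comp a.contMDiff).of_le (mod_cast le_top)) fun e => ?_
  · have h1 := h.anchor_smul t ⟨e, X e⟩
    rw [← hX.map_smul t e] at h1
    exact (TotalSpace.mk_inj.1 h1).symm
  · exact (h.anchor_covers e (X e)).trans (congrArg _ (hX.covers e))

theorem isComplete_of_isLinearConnection (h : IsVBAlgebroid 𝒟 LD LA)
    {H : EhresmannConnection (𝓘(ℝ, EM).prod 𝓘(ℝ, FE)) F₁ (TotalSpace.proj : TotalSpace FE E → M) 𝒟.p}
    (hH : 𝒟.IsLinearConnection H) : H.IsComplete LD LA := fun a ha => by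
  obtain ⟨X, hXH, hX⟩ := hH a
  exact ⟨X, hXH, h.isCompleteVectorField_of_isLinearSection hX ha⟩

variable [SecondCountableTopology M]

theorem isLieAlgebroidExtension (h : IsVBAlgebroid 𝒟 LD LA) :
    IsLieAlgebroidExtension LD LA (TotalSpace.proj : TotalSpace FE E → M) 𝒟.p where
  isMorphism := by
    refine ⟨contMDiff_proj E, 𝒟.contMDiff_p, fun e d => (h.anchor_covers e d).symm, ?_⟩
    obtain ⟨θ, hθ⟩ := 𝒟.exists_isLinearLiftOn_univ
    -- The linear lifts serve as `hor`; the VB-algebroid axioms supply the three kinds of brackets.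
    choose hor hhor hlin using hθ.isLinearConnection
    exact LD.map_bracket_eq_sum_of_lift hor (fun a => (hlin a).covers)
      (fun a c => (h.bracket_linear_linear _ _ _ _ (hlin a) (hlin c)).covers)
      (fun a Y hY => h.p_bracket_linear_ker (hlin a) hY) fun X Y hX hY => h.p_bracket_ker_ker hX hY
  surjective_base m := ⟨⟨m, 0⟩, rfl⟩
  isSubmersion_base := isSubmersion_totalSpace_proj
  surjective_map := 𝒟.p_surjective

theorem isLieSubalgebroid_ker (h : IsVBAlgebroid 𝒟 LD LA) :
    LD.IsLieSubalgebroid fun e => LinearMap.ker (𝒟.p e) :=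
  ⟨𝒟.isSmoothSubbundle_ker, fun _ _ hX hY => h.p_bracket_ker_ker hX hY⟩

end IsVBAlgebroid

end

theorem proposition3
    {EM : Type*} [NormedAddCommGroup EM] [NormedSpace ℝ EM] [FiniteDimensional ℝ EM]
    {M : Type*} [TopologicalSpace M] [T2Space M] [SecondCountableTopology M]
    [ChartedSpace EM M] [IsManifold 𝓘(ℝ, EM) ∞ M]
    {FA : Type*} [NormedAddCommGroup FA] [NormedSpace ℝ FA] [FiniteDimensional ℝ FA]
    {A : M → Type*} [TopologicalSpace (TotalSpace FA A)]
    [∀ m, AddCommGroup (A m)] [∀ m, Module ℝ (A m)] [∀ m, TopologicalSpace (A m)]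
    [FiberBundle FA A] [VectorBundle ℝ FA A] [ContMDiffVectorBundle ∞ FA A 𝓘(ℝ, EM)]
    {FE : Type*} [NormedAddCommGroup FE] [NormedSpace ℝ FE] [FiniteDimensional ℝ FE]
    {E : M → Type*} [TopologicalSpace (TotalSpace FE E)]
    [∀ m, AddCommGroup (E m)] [∀ m, Module ℝ (E m)] [∀ m, TopologicalSpace (E m)]
    [FiberBundle FE E] [VectorBundle ℝ FE E] [ContMDiffVectorBundle ∞ FE E 𝓘(ℝ, EM)]
    {F₁ : Type*} [NormedAddCommGroup F₁] [NormedSpace ℝ F₁] [FiniteDimensional ℝ F₁]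
    {D₁ : TotalSpace FE E → Type*} [TopologicalSpace (TotalSpace F₁ D₁)]
    [∀ e, AddCommGroup (D₁ e)] [∀ e, Module ℝ (D₁ e)] [∀ e, TopologicalSpace (D₁ e)]
    [FiberBundle F₁ D₁] [VectorBundle ℝ F₁ D₁]
    [ContMDiffVectorBundle ∞ F₁ D₁ (𝓘(ℝ, EM).prod 𝓘(ℝ, FE))]
    {F₂ : Type*} [NormedAddCommGroup F₂] [NormedSpace ℝ F₂] [FiniteDimensional ℝ F₂]
    {D₂ : TotalSpace FA A → Type*} [TopologicalSpace (TotalSpace F₂ D₂)]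
    [∀ a, AddCommGroup (D₂ a)] [∀ a, Module ℝ (D₂ a)] [∀ a, TopologicalSpace (D₂ a)]
    [FiberBundle F₂ D₂] [VectorBundle ℝ F₂ D₂]
    [ContMDiffVectorBundle ∞ F₂ D₂ (𝓘(ℝ, EM).prod 𝓘(ℝ, FA))]
    (𝒟 : DoubleVectorBundle (EM := EM) FA A FE E F₁ D₁ F₂ D₂)
    (LD : LieAlgebroid (𝓘(ℝ, EM).prod 𝓘(ℝ, FE)) F₁ D₁)
    (LA : LieAlgebroid 𝓘(ℝ, EM) FA A)
    (h𝒟 : IsVBAlgebroid 𝒟 LD LA) :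
    -- `p : D → A` is a Lie algebroid fibration over `p_E : E → M`
    IsLieAlgebroidFibration LD LA (TotalSpace.proj : TotalSpace FE E → M) 𝒟.p ∧
    -- its kernel is a Lie subalgebroid of `D`, canonically identified with `p_E^* C`
    LD.IsLieSubalgebroid (fun e => LinearMap.ker (𝒟.p e)) ∧
    (∃ k, Nonempty (𝒟.CoreBundle k)) ∧
    (∀ k [𝒟.CoreBundle k], ∃ i, 𝒟.IsKernelIso k i) ∧
    -- linear connections exist, and they are complete
    (∃ h, 𝒟.IsLinearConnection h) ∧
    (∀ h, 𝒟.IsLinearConnection h → h.IsComplete LD LA) := by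
  obtain ⟨θ, hθ⟩ := 𝒟.exists_isLinearLiftOn_univ
  exact ⟨⟨h𝒟.isLieAlgebroidExtension, hθ.connection,
      h𝒟.isComplete_of_isLinearConnection hθ.isLinearConnection⟩,
    h𝒟.isLieSubalgebroid_ker, ⟨_, 𝒟.nonempty_coreBundle⟩, fun k => 𝒟.exists_isKernelIso k,
    ⟨hθ.connection, hθ.isLinearConnection⟩, fun _ => h𝒟.isComplete_of_isLinearConnection⟩
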